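/- A multi-layer graph $\mathcal G=(V,\{C_1,\dots,C_\tau\},R)$ consists of a finite vertex set $V$ with $n$ elements, of $\tau\ge 1$ cop layers $C_i$ and of a robber layer $R$, each of which is the edge set of a simple graph on $V$, not necessarily connected. An allocation $\mathbf k=(k_1,\dots,k_\tau)$ puts $k_i$ cops in layer $C_i$. In the game, the cop player first places all cops on vertices, then the robber is placed on a vertex; then the players alternate, cops first. On the cop player's turn each cop stays or moves along one edge of its own layer; on the robber's turn the robber stays or moves along one edge of $R$. The cops win if at some point a cop and the robber are on the same vertex, and the robber wins if this never happens. The problem *Multi-layer cops and robber* asks, given $(\mathcal G,k)$ with $k\ge1$, whether there is an allocation with $\sum_i k_i=k$ for which the cop player has a winning strategy. Given a placement of the cops on vertices, a cop can reach a vertex if there is a path to it from the cop's vertex in the cop's layer. An edge $uv$ of $R$ is a *robber's edge* for the placement if (a) $u$ or $v$ can be reached by no cop, or (b) there is a cop $c$ such that no other cop can reach $u$ or $v$, and the distance between $u$ and $v$ in the layer of $c$ is at least $3$ (possibly infinite). **Theorem.** (1) There are an algorithm, a computable function $f$ and a polynomial $\mathrm{poly}$ such that, for every multi-layer graph $\mathcal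 G=(V,\{C_1,\dots,C_\tau\},R)$ with $n$ vertices in which $R$ is a tree on $V$ and every $k\ge 1$, the algorithm decides Multi-layer cops and robber on $(\mathcal G,k)$ in at most $f(k,\tau)\cdot\mathrm{poly}(n)$ steps. (Algorithm and steps are those of a unit-cost random-access machine with addition and subtraction; the layers are given by adjacency matrices.) (2) Let $R$ be a tree on $V$ and let $\mathbf k$ be an allocation of $\sum_i k_i\ge1$ cops. For every placement of the cops, the cop player has a winning strategy that starts with this placement if and only if there is no robber's edge for the placement. Consequently, the cop player has a winning strategy for the allocation $\mathbf k$ if and only if there is a placement of its cops for which no robber's edge exists. -/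

import Mathlib

/-! ## Multi-layer graphs and the game of multi-layer cops and robbers -/

/-- A multi-layer graph on the vertex set `V` with `τ` cop layers and one robber layer. -/
structure MultiLayerGraph (V : Type*) (τ : ℕ) where
  copLayer : Fin τ → SimpleGraph V
  robberLayer : SimpleGraph V

namespace MultiLayerGraph

variable {V : Type*} {τ : ℕ}

/-- The cops of an allocation `κ`: there are exactly `κ i` of them in layer `i`, and the
first component of a cop is its layer. -/
abbrev Cop (κ : Fin τ → ℕ) : Type := Σ i : Fin τ, Fin (κ i)

/-- A strategy of the cop player gives the positions of the cops as a function of the list of all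
positions that the robber has occupied so far (oldest first); its value at the empty list
is the initial placement, which is chosen before the robber is placed.
It is legal if on every turn each cop stays or moves along one edge of its own layer. -/
def LegalCopStrategy (G : MultiLayerGraph V τ) (κ : Fin τ → ℕ)
    (S : List V → Cop κ → V) : Prop :=
  ∀ (h : List V) (v : V) (c : Cop κ),
    S (h ++ [v]) c = S h c ∨ (G.copLayer c.1).Adj (S h c) (S (h ++ [v]) c)

/-- An infinite play of the robber: `r 0` is the start vertex, and on every turn the robber stays
or moves along one edge of the robber layer. -/
def LegalRobberPlay (G : MultiLayerGraph V τ) (r : ℕ → V) : Prop :=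
  ∀ t : ℕ, r (t + 1) = r t ∨ G.robberLayer.Adj (r t) (r (t + 1))

/-- The positions of the cops after `t` cop turns, if the robber plays `r`. -/
def copPosition {κ : Fin τ → ℕ} (S : List V → Cop κ → V) (r : ℕ → V) (t : ℕ) : Cop κ → V :=
  S ((List.range t).map r)

/-- At some point some cop is on the robber's vertex: either right after the robber's placement or
move number `t`, or right after the cop turn that follows it. -/
def Captures {κ : Fin τ → ℕ} (S : List V → Cop κ → V) (r : ℕ → V) : Prop :=
  ∃ (t : ℕ) (c : Cop κ), copPosition S r t c = r t ∨ copPosition S r (t + 1) c = r t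

/-- The cop player has a winning strategy that places the cops initially according to `p`. -/
def CopsWinFrom (G : MultiLayerGraph V τ) (κ : Fin τ → ℕ) (p : Cop κ → V) : Prop :=
  ∃ S : List V → Cop κ → V, S [] = p ∧ G.LegalCopStrategy κ S ∧
    ∀ r : ℕ → V, G.LegalRobberPlay r → Captures S r

/-- The question of `Allocated multi-layer cops and robber`: with the allocation `κ`, does the cop
player have a winning strategy (which includes the choice of the initial placement)? -/
def AllocatedMultiLayerCopsAndRobber (G : MultiLayerGraph V τ) (κ : Fin τ → ℕ) : Prop :=
  ∃ p : Cop κ → V, G.CopsWinFrom κ p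

/-- The question of `Multi-layer cops and robber`. -/
def MultiLayerCopsAndRobber (G : MultiLayerGraph V τ) (k : ℕ) : Prop :=
  ∃ κ : Fin τ → ℕ, ∑ i, κ i = k ∧ G.AllocatedMultiLayerCopsAndRobber κ

/-- Cop `c`, placed according to `p`, can reach the vertex `v` in its own layer. -/
def CanReach (G : MultiLayerGraph V τ) {κ : Fin τ → ℕ} (p : Cop κ → V) (c : Cop κ) (v : V) :
    Prop :=
  (G.copLayer c.1).Reachable (p c) v

/-- The edge `uv` of the robber layer is a robber's edge for the placement `p`: an end of it is
reachable by no cop at all, or there is a cop `c` such that no other cop can reach `u` or `v`, and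
the distance from `u` to `v` in the layer of `c` is at least `3` (possibly infinite). -/
def IsRobbersEdge (G : MultiLayerGraph V τ) {κ : Fin τ → ℕ} (p : Cop κ → V) (u v : V) : Prop :=
  G.robberLayer.Adj u v ∧
    ((∀ c, ¬ G.CanReach p c u) ∨ (∀ c, ¬ G.CanReach p c v) ∨
      ∃ c : Cop κ, (∀ c' : Cop κ, G.CanReach p c' u ∨ G.CanReach p c' v → c' = c) ∧
        3 ≤ (G.copLayer c.1).edist u v)

end MultiLayerGraph

/-! ## Random-access machines with a step count

Programs of a random-access machine in structured form. There are registers and arrays, both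
numbered by natural numbers (a program mentions only finitely many of them); all of them hold
natural numbers, and an array is addressed indirectly, through a register. The only arithmetic
operations are addition and truncated subtraction, so that unit cost is polynomially related to
the running time of a Turing machine. -/

namespace RAM

/-- The contents of the registers and of the arrays. -/
structure State where
  reg : ℕ → ℕ
  arr : ℕ → ℕ → ℕ

/-- Write `v` into register `x`. -/
def State.setReg (s : State) (x v : ℕ) : State :=
  { s with reg := Function.update s.reg x v }

/-- Write `v` into cell `j` of array `a`. -/
def State.setArr (s : State) (a j v : ℕ) : State :=
  { s with arr := Function.update s.arr a (Function.update (s.arr a) j v) }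

inductive Prog : Type
  /-- `r_x := m` -/
  | const (x m : ℕ) : Prog
  /-- `r_x := r_y + r_z` -/
  | add (x y z : ℕ) : Prog
  /-- `r_x := max (r_y - r_z) 0` -/
  | sub (x y z : ℕ) : Prog
  /-- `r_x := a[r_y]` -/
  | load (x a y : ℕ) : Prog
  /-- `a[r_y] := r_x` -/
  | store (a y x : ℕ) : Prog
  /-- first `P`, then `Q` -/
  | seq (P Q : Prog) : Prog
  /-- if `r_x ≠ 0` then `P` else `Q` -/
  | ite (x : ℕ) (P Q : Prog) : Prog
  /-- while `r_x ≠ 0` do `P` -/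
  | loop (x : ℕ) (P : Prog) : Prog

/-- `Exec P s t s'`: started in `s`, the program `P` halts in `s'` after exactly `t` steps. Every
assignment and every evaluation of a test is one step. -/
inductive Exec : Prog → State → ℕ → State → Prop
  | const (x m : ℕ) (s : State) : Exec (.const x m) s 1 (s.setReg x m)
  | add (x y z : ℕ) (s : State) : Exec (.add x y z) s 1 (s.setReg x (s.reg y + s.reg z))
  | sub (x y z : ℕ) (s : State) : Exec (.sub x y z) s 1 (s.setReg x (s.reg y - s.reg z))
  | load (x a y : ℕ) (s : State) : Exec (.load x a y) s 1 (s.setReg x (s.arr a (s.reg y)))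
  | store (a y x : ℕ) (s : State) : Exec (.store a y x) s 1 (s.setArr a (s.reg y) (s.reg x))
  | seq {P Q : Prog} {s s' s'' : State} {t t' : ℕ} :
      Exec P s t s' → Exec Q s' t' s'' → Exec (.seq P Q) s (t + t') s''
  | ite_true {x : ℕ} {P Q : Prog} {s s' : State} {t : ℕ} :
      s.reg x ≠ 0 → Exec P s t s' → Exec (.ite x P Q) s (t + 1) s'
  | ite_false {x : ℕ} {P Q : Prog} {s s' : State} {t : ℕ} :
      s.reg x = 0 → Exec Q s t s' → Exec (.ite x P Q) s (t + 1) s'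
  | loop_done {x : ℕ} {P : Prog} {s : State} :
      s.reg x = 0 → Exec (.loop x P) s 1 s
  | loop_step {x : ℕ} {P : Prog} {s s' s'' : State} {t t' : ℕ} :
      s.reg x ≠ 0 → Exec P s t s' → Exec (.loop x P) s' t' s'' →
        Exec (.loop x P) s (t + t' + 1) s''

/-- A program has at most one outcome, so `Exec` is the graph of a partial function. -/
theorem Exec.deterministic {P : Prog} {s s₁ s₂ : State} {t₁ t₂ : ℕ}
    (h₁ : Exec P s t₁ s₁) (h₂ : Exec P s t₂ s₂) : t₁ = t₂ ∧ s₁ = s₂ := by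
  induction h₁ generalizing t₂ s₂ with
  | const | add | sub | load | store => cases h₂; exact ⟨rfl, rfl⟩
  | seq _ _ ih ih' =>
    cases h₂ with
    | seq a b =>
      obtain ⟨rfl, rfl⟩ := ih a
      obtain ⟨rfl, rfl⟩ := ih' b
      exact ⟨rfl, rfl⟩
  | ite_true hx _ ih =>
    cases h₂ with
    | ite_true _ a => obtain ⟨rfl, rfl⟩ := ih a; exact ⟨rfl, rfl⟩
    | ite_false hx' _ => exact absurd hx' hx
  | ite_false hx _ ih =>
    cases h₂ with
    | ite_true hx' _ => exact absurd hx hx'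
    | ite_false _ a => obtain ⟨rfl, rfl⟩ := ih a; exact ⟨rfl, rfl⟩
  | loop_done hx =>
    cases h₂ with
    | loop_done => exact ⟨rfl, rfl⟩
    | loop_step hx' _ _ => exact absurd hx hx'
  | loop_step hx _ _ ih ih' =>
    cases h₂ with
    | loop_done hx' => exact absurd hx' hx
    | loop_step _ a b =>
      obtain ⟨rfl, rfl⟩ := ih a
      obtain ⟨rfl, rfl⟩ := ih' b
      exact ⟨rfl, rfl⟩

open Classical in
/-- The input state for a multi-layer graph `G` on the vertices `0, …, n - 1` and a number `k`.
Registers `0, 1, 2` hold `n, τ, k`. Array `0` holds the adjacency matrices of the cop layers one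
after the other: cell `(i * n + u) * n + v` is `1` if `uv` is an edge of cop layer `i`. Array `1`
holds the adjacency matrix of the robber layer: cell `u * n + v` is `1` if `uv` is an edge of it.
Everything else is `0`. -/
noncomputable def inputState {n τ : ℕ} (G : MultiLayerGraph (Fin n) τ) (k : ℕ) : State where
  reg x := if x = 0 then n else if x = 1 then τ else if x = 2 then k else 0
  arr a j :=
    if a = 0 then
      if ∃ (i : Fin τ) (u v : Fin n), j = ((i : ℕ) * n + u) * n + v ∧ (G.copLayer i).Adj u v
        then 1 else 0
    else if a = 1 then
      if ∃ u v : Fin n, j = (u : ℕ) * n + v ∧ G.robberLayer.Adj u v then 1 else 0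
    else 0

end RAM

/-! The game. If an end of a robber's edge is reachable by no cop, the robber stays there forever.
Otherwise a single cop `c` matters on the edge, and since its ends are at distance at least 3 in the
layer of `c`, some end is always at distance at least 2 from `c`; the robber always goes to such an
end, and `c` cannot catch up in one turn (`not_copsWinFrom_of_robbersEdge`).

Conversely, a cop on `v` confines the robber to one branch of the tree at `v`, say the one behind
the edge `vw`, because `v` is its only exit. It suffices to bring a cop to `w` without letting the
robber out: the branch then shrinks, and induction on its size finishes. A second cop that can reach
`w` walks there while the first one guards `v`. If only the guard can reach `w` but another cop can
reach `v`, the other cop first takes over the guard. If the guard is the only cop that can reach `v`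
or `w`, then `v` and `w` are at distance at most 2 in its layer, and it moves to a midpoint, from
where it answers both an escape to `v` and a stay in the branch (`wins_of_mem_branch`).

The algorithm. By this criterion only the layer and the component of each cop matter. An edge `uv`
is secure if both ends are reached and the cops that reach an end have total weight at least 2,
where a cop weighs 2 if `u` and `v` are near in its layer and 1 otherwise (`isRobbersEdge_iff`). If
a partial placement leaves `uv` insecure, every solution that extends it has a further cop that
reaches `u` or `v`, and this cop may be moved to that end. So there are `2 * τ` choices for the next
cop, and `(2 * τ) ^ k` codes describe the whole search tree (`exists_code`).

The machine. The search is written in a language whose loops are bounded by the parameters `n`, `τ`,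
`k` and `(2 * τ) ^ k`, which never change. Its compilation to the machine is verified once
(`Exp.run_compile`, `Cmd.run_compile`), and the cost of a fixed program is polynomially bounded in
the parameters (`Cmd.powBounded_cost`). Such a bound splits into a factor in `k` and `τ` and a power
of `n + 2`. -/

/-! ## Branches of a tree -/

namespace SimpleGraph

variable {V : Type*}

/-- The vertices that remain connected to `w` when the edge `vw` is deleted. -/
def branch (R : SimpleGraph V) (v w : V) : Set V :=
  {x | (R.deleteEdges {s(v, w)}).Reachable w x}

theorem mem_branch_self (R : SimpleGraph V) (v w : V) : w ∈ R.branch v w :=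
  Reachable.refl w

theorem IsAcyclic.notMem_branch {R : SimpleGraph V} (hR : R.IsAcyclic) {v w : V}
    (h : R.Adj v w) : v ∉ R.branch v w := fun hv =>
  isAcyclic_iff_forall_adj_isBridge.1 hR h (Reachable.symm hv)

/-- The edge `vw` is the only one that leaves the branch, so a cop on `v` confines the robber. -/
theorem IsAcyclic.mem_branch_or_eq {R : SimpleGraph V} (hR : R.IsAcyclic) {v w x y : V}
    (h : R.Adj v w) (hx : x ∈ R.branch v w) (hxy : y = x ∨ R.Adj x y) :
    y ∈ R.branch v w ∨ y = v := by
  rcases hxy with rfl | hxy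
  · exact Or.inl hx
  by_cases he : s(x, y) = s(v, w)
  · rcases Sym2.eq_iff.1 he with ⟨rfl, rfl⟩ | ⟨rfl, rfl⟩
    · exact absurd hx (hR.notMem_branch h)
    · exact Or.inr rfl
  · exact Or.inl (Reachable.trans hx (deleteEdges_adj.2 ⟨hxy, he⟩).reachable)

/-- The subgraph `H` keeps control of the first edge: with `vw` deleted, the next branch at `w` does
not lead back to `v`. At the start of the game `H = R`. -/
theorem exists_mem_branch {R H : SimpleGraph V} (hH : H ≤ R) {v x : V}
    (hx : H.Reachable v x) : x = v ∨ ∃ w, H.Adj v w ∧ x ∈ R.branch v w := by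
  rw [reachable_iff_reflTransGen] at hx
  induction hx with
  | refl => exact Or.inl rfl
  | @tail y x _ hyx ih =>
    by_cases hxv : x = v
    · exact Or.inl hxv
    right
    rcases ih with rfl | ⟨w, hw, hy⟩
    · exact ⟨x, hyx, R.mem_branch_self _ _⟩
    · refine ⟨w, hw, ?_⟩
      by_cases he : s(y, x) = s(v, w)
      · rcases Sym2.eq_iff.1 he with ⟨rfl, rfl⟩ | ⟨rfl, rfl⟩
        · exact R.mem_branch_self _ _
        · exact absurd rfl hxv
      · exact Reachable.trans hy (deleteEdges_adj.2 ⟨hH hyx, he⟩).reachable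

theorem IsAcyclic.branch_ssubset {R : SimpleGraph V} (hR : R.IsAcyclic) {v w w' : V}
    (hww' : (R.deleteEdges {s(v, w)}).Adj w w') : R.branch w w' ⊂ R.branch v w := by
  have hadj : R.Adj w w' := (deleteEdges_adj.1 hww').1
  refine ⟨fun x hx => ?_, fun hsub => hR.notMem_branch hadj (hsub (R.mem_branch_self v w))⟩
  have hx' : Relation.ReflTransGen (R.deleteEdges {s(w, w')}).Adj w' x :=
    (reachable_iff_reflTransGen _ _).1 hx
  induction hx' with
  | refl => exact hww'.reachable
  | @tail y z hy hyz ih =>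
    have hy' : y ∈ R.branch w w' := (reachable_iff_reflTransGen _ _).2 hy
    refine Reachable.trans (ih hy') (deleteEdges_adj.2 ⟨(deleteEdges_adj.1 hyz).1, ?_⟩).reachable
    -- The edge `vw` is not used inside the smaller branch, since that would put `w` into it.
    intro he
    rcases Sym2.eq_iff.1 he with ⟨-, rfl⟩ | ⟨rfl, -⟩
    · exact hR.notMem_branch hadj hx
    · exact hR.notMem_branch hadj hy'

/-- The midpoint may coincide with an end, which covers the distances 0 and 1. -/
theorem edist_lt_three_iff {G : SimpleGraph V} {u v : V} :
    G.edist u v < 3 ↔ ∃ m, (m = u ∨ G.Adj u m) ∧ (v = m ∨ G.Adj m v) := by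
  constructor
  · intro h
    obtain ⟨p, hp⟩ := (reachable_of_edist_ne_top (ne_top_of_lt h)).exists_walk_length_eq_edist
    rw [← hp] at h
    have h' : p.length < 3 := by exact_mod_cast h
    match p, h' with
    | .nil, _ => exact ⟨u, Or.inl rfl, Or.inl rfl⟩
    | .cons h₁ .nil, _ => exact ⟨v, Or.inr h₁, Or.inl rfl⟩
    | .cons h₁ (.cons h₂ .nil), _ => exact ⟨_, Or.inr h₁, Or.inr h₂⟩
    | .cons _ (.cons _ (.cons _ _)), h' => simp at h'; omega
  · rintro ⟨m, h₁, h₂⟩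
    have one : ∀ {a b : V}, (b = a ∨ G.Adj a b) → G.edist a b ≤ 1 := by
      rintro a b (rfl | h)
      · simp
      · exact (edist_eq_one_iff_adj.2 h).le
    calc G.edist u v ≤ G.edist u m + G.edist m v := G.edist_triangle
      _ ≤ 1 + 1 := add_le_add (one h₁) (one h₂)
      _ < 3 := by decide

end SimpleGraph

/-! ## The game on a tree -/

namespace MultiLayerGraph

variable {V : Type*} {τ : ℕ} {κ : Fin τ → ℕ}

/-- A legal cop turn from `q` to `q'`. -/
def CopTurn (G : MultiLayerGraph V τ) (q q' : Cop κ → V) : Prop :=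
  ∀ c, q' c = q c ∨ (G.copLayer c.1).Adj (q c) (q' c)

/-- With the cops on `q`, the robber on `r` and the cops to move, the cops can catch the robber
within `n` turns. -/
def WinsWithin (G : MultiLayerGraph V τ) : ℕ → (Cop κ → V) → V → Prop
  | 0, _, _ => False
  | n + 1, q, r => ∃ q', G.CopTurn q q' ∧
      ((∃ c, q' c = r) ∨ ∀ r', (r' = r ∨ G.robberLayer.Adj r r') → G.WinsWithin n q' r')

theorem WinsWithin.succ {G : MultiLayerGraph V τ} {n : ℕ} {q : Cop κ → V} {r : V}
    (h : G.WinsWithin n q r) : G.WinsWithin (n + 1) q r := by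
  induction n generalizing q r with
  | zero => exact h.elim
  | succ n ih =>
    obtain ⟨q', hq, h⟩ := h
    exact ⟨q', hq, h.imp_right fun h r' hr => ih (h r' hr)⟩

theorem WinsWithin.mono {G : MultiLayerGraph V τ} {m n : ℕ} (hmn : m ≤ n) {q : Cop κ → V} {r : V}
    (h : G.WinsWithin m q r) : G.WinsWithin n q r := by
  induction hmn with
  | refl => exact h
  | step _ ih => exact ih.succ

/-- The cops can catch the robber within a bounded number of turns. -/
def Wins (G : MultiLayerGraph V τ) (q : Cop κ → V) (r : V) : Prop :=
  ∃ n, G.WinsWithin n q r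

/-- As there are finitely many robber positions, the bounds have a maximum; this makes `Wins`
composable turn by turn. -/
theorem exists_winsWithin_of_forall [Finite V] {G : MultiLayerGraph V τ} {P : V → Prop}
    {q : Cop κ → V} (h : ∀ r, P r → G.Wins q r) : ∃ n, ∀ r, P r → G.WinsWithin n q r := by
  have hn : ∀ r, ∃ n, P r → G.WinsWithin n q r := fun r => by
    by_cases hr : P r
    · exact (h r hr).imp fun _ h _ => h
    · exact ⟨0, fun h => absurd h hr⟩
  choose f hf using hn
  obtain ⟨N, hN⟩ := (Set.finite_range f).bddAbove
  exact ⟨N, fun r hr => (hf r hr).mono (hN ⟨r, rfl⟩)⟩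

theorem CopTurn.refl (G : MultiLayerGraph V τ) (q : Cop κ → V) : G.CopTurn q q :=
  fun _ => Or.inl rfl

theorem copTurn_update (G : MultiLayerGraph V τ) [DecidableEq (Cop κ)] {q : Cop κ → V}
    {c : Cop κ} {x : V} (h : x = q c ∨ (G.copLayer c.1).Adj (q c) x) :
    G.CopTurn q (Function.update q c x) := by
  intro c'
  by_cases hc : c' = c
  · subst hc; simpa using h
  · simp [hc]

theorem Wins.catch {G : MultiLayerGraph V τ} {q q' : Cop κ → V} {r : V} (hq : G.CopTurn q q')
    (c : Cop κ) (h : q' c = r) : G.Wins q r :=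
  ⟨1, q', hq, Or.inl ⟨c, h⟩⟩

theorem Wins.turn [Finite V] {G : MultiLayerGraph V τ} {q q' : Cop κ → V} {r : V}
    (hq : G.CopTurn q q') (h : ∀ r', (r' = r ∨ G.robberLayer.Adj r r') → G.Wins q' r') :
    G.Wins q r := by
  obtain ⟨n, hn⟩ := exists_winsWithin_of_forall h
  exact ⟨n + 1, q', hq, Or.inr hn⟩

/-- One turn of the strategy that keeps track of a bound on the number of remaining turns. -/
noncomputable def nextTurn (G : MultiLayerGraph V τ) (x : ℕ × (Cop κ → V)) (r : V) :
    ℕ × (Cop κ → V) :=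
  open Classical in
  if h : ∃ y : ℕ × (Cop κ → V), y.1 + 1 = x.1 ∧ G.CopTurn x.2 y.2 ∧
      ((∃ c, y.2 c = r) ∨ ∀ r', (r' = r ∨ G.robberLayer.Adj r r') → G.WinsWithin y.1 y.2 r')
    then h.choose else x

theorem copsWinFrom_of_forall_wins [Finite V] {G : MultiLayerGraph V τ} {p : Cop κ → V}
    (h : ∀ r, G.Wins p r) : G.CopsWinFrom κ p := by
  obtain ⟨N, hN⟩ := exists_winsWithin_of_forall (P := fun _ => True) fun r _ => h r
  refine ⟨fun l => (l.foldl G.nextTurn (N, p)).2, rfl, fun l v => ?_, fun r hr => ?_⟩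
  · simp only [List.foldl_append, List.foldl_cons, List.foldl_nil]
    generalize l.foldl G.nextTurn (N, p) = x
    unfold nextTurn
    split_ifs with hx
    · exact hx.choose_spec.2.1
    · exact CopTurn.refl G _
  · let st : ℕ → ℕ × (Cop κ → V) := fun t => ((List.range t).map r).foldl G.nextTurn (N, p)
    have hst : ∀ t, st (t + 1) = G.nextTurn (st t) (r t) := fun t => by
      simp [st, List.range_succ]
    -- The first component of the state drops by one in every turn without a capture, so the play
    -- cannot outlast it.
    suffices H : ∀ n t, (st t).1 = n → G.WinsWithin n (st t).2 (r t) →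
        ∃ (t : ℕ) (c : Cop κ), (st t).2 c = r t ∨ (st (t + 1)).2 c = r t from
      H N 0 rfl (hN _ trivial)
    intro n
    induction n with
    | zero => exact fun _ _ h => h.elim
    | succ n ih =>
      rintro t ht ⟨q', hq, hw⟩
      have hx : ∃ y : ℕ × (Cop κ → V), y.1 + 1 = (st t).1 ∧ G.CopTurn (st t).2 y.2 ∧
          ((∃ c, y.2 c = r t) ∨
            ∀ r', (r' = r t ∨ G.robberLayer.Adj (r t) r') → G.WinsWithin y.1 y.2 r') :=
        ⟨(n, q'), ht.symm, hq, hw⟩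
      have hs : st (t + 1) = hx.choose := by
        rw [hst, nextTurn, dif_pos hx]
      obtain ⟨h1, -, h3⟩ := hx.choose_spec
      rw [← hs] at h1 h3
      rcases h3 with ⟨c, hc⟩ | h3
      · exact ⟨t, c, Or.inr hc⟩
      · have h1' : (st (t + 1)).1 = n := by omega
        exact ih (t + 1) h1' (h1' ▸ h3 _ (hr t))

theorem reachable_of_copTurn {G : MultiLayerGraph V τ} {p q q' : Cop κ → V}
    (hq : ∀ c, G.CanReach p c (q c)) (h : G.CopTurn q q') (c : Cop κ) :
    G.CanReach p c (q' c) := by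
  rcases h c with h | h
  · rw [h]; exact hq c
  · exact (hq c).trans h.reachable

/-- While `b` walks, `c` stays on `v`, and a robber who leaves the branch steps onto `c`. The
hypothesis `hfin` says how to win after the walk. -/
theorem wins_of_walk [Finite V] {G : MultiLayerGraph V τ} (hR : G.robberLayer.IsAcyclic)
    {p : Cop κ → V} {v w : V} (hvw : G.robberLayer.Adj v w) {c b : Cop κ} (hcb : b ≠ c) {x y : V}
    (l : (G.copLayer b.1).Walk x y)
    (hfin : ∀ (q : Cop κ → V) (r : V), (∀ c, G.CanReach p c (q c)) → q c = v → q b = y →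
      r ∈ G.robberLayer.branch v w → G.Wins q r)
    (q : Cop κ → V) (r : V) (hq : ∀ c, G.CanReach p c (q c)) (hc : q c = v) (hb : q b = x)
    (hr : r ∈ G.robberLayer.branch v w) : G.Wins q r := by
  classical
  induction l generalizing q r with
  | nil => exact hfin q r hq hc hb hr
  | @cons x x' y hx l ih =>
    have ht : G.CopTurn q (Function.update q b x') :=
      copTurn_update G (Or.inr (hb ▸ hx))
    have hc' : Function.update q b x' c = v := by rw [Function.update_of_ne hcb.symm, hc]
    refine Wins.turn ht fun r' hr' => ?_
    rcases hR.mem_branch_or_eq hvw hr hr' with h | rfl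
    · exact ih hfin _ r' (reachable_of_copTurn hq ht) hc' (by simp) h
    · exact Wins.catch (CopTurn.refl G _) c hc'

theorem wins_of_walk_unguarded [Finite V] {G : MultiLayerGraph V τ} {p : Cop κ → V} {b : Cop κ}
    {x y : V} (l : (G.copLayer b.1).Walk x y)
    (hfin : ∀ (q : Cop κ → V) (r : V), (∀ c, G.CanReach p c (q c)) → q b = y → G.Wins q r)
    (q : Cop κ → V) (r : V) (hq : ∀ c, G.CanReach p c (q c)) (hb : q b = x) : G.Wins q r := by
  classical
  induction l generalizing q r with
  | nil => exact hfin q r hq hb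
  | @cons x x' y hx l ih =>
    have ht : G.CopTurn q (Function.update q b x') := copTurn_update G (Or.inr (hb ▸ hx))
    exact Wins.turn ht fun r' _ => ih hfin _ r' (reachable_of_copTurn hq ht) (by simp)

/-- Once `b` is on `w`, the robber is on `w` or in a strictly smaller branch at `w` that `b` now
guards; the old guard is no longer needed. -/
theorem wins_of_arrive [Finite V] {G : MultiLayerGraph V τ} (hR : G.robberLayer.IsAcyclic)
    {p : Cop κ → V} {v w : V} {b : Cop κ}
    (ih : ∀ w', G.robberLayer.Adj w w' →
      G.robberLayer.branch w w' ⊂ G.robberLayer.branch v w → ∀ (q : Cop κ → V) (r : V),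
      (∀ c, G.CanReach p c (q c)) → q b = w → r ∈ G.robberLayer.branch w w' → G.Wins q r)
    {q q' : Cop κ → V} {r : V} (hq : ∀ c, G.CanReach p c (q c)) (ht : G.CopTurn q q')
    (hb : q' b = w) (hr : r ∈ G.robberLayer.branch v w) : G.Wins q r := by
  rcases SimpleGraph.exists_mem_branch (SimpleGraph.deleteEdges_le _) hr with rfl | ⟨w', hw', hr'⟩
  · exact Wins.catch ht b hb
  · have hww' := (SimpleGraph.deleteEdges_adj.1 hw').1
    refine Wins.turn ht fun r'' hr'' => ?_
    rcases hR.mem_branch_or_eq hww' hr' hr'' with h | rfl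
    · exact ih w' hww' (hR.branch_ssubset hw') q' r'' (reachable_of_copTurn hq ht) hb h
    · exact Wins.catch (CopTurn.refl G _) b hb

theorem wins_of_mem_branch [Finite V] {G : MultiLayerGraph V τ} (hR : G.robberLayer.IsAcyclic)
    {p : Cop κ → V} (hp : ¬ ∃ u v : V, G.IsRobbersEdge p u v) (n : ℕ) {v w : V}
    (hn : (G.robberLayer.branch v w).ncard ≤ n) (hvw : G.robberLayer.Adj v w) {c : Cop κ}
    {q : Cop κ → V} {r : V} (hq : ∀ c, G.CanReach p c (q c)) (hc : q c = v)
    (hr : r ∈ G.robberLayer.branch v w) : G.Wins q r := by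
  classical
  induction n generalizing v w c q r with
  | zero =>
    have := (Set.ncard_pos (Set.toFinite _)).2 ⟨r, hr⟩
    omega
  | succ n ih =>
    have ih' : ∀ (b : Cop κ) (w' : V), G.robberLayer.Adj w w' →
        G.robberLayer.branch w w' ⊂ G.robberLayer.branch v w → ∀ (q : Cop κ → V) (r : V),
        (∀ c, G.CanReach p c (q c)) → q b = w → r ∈ G.robberLayer.branch w w' → G.Wins q r := by
      intro b w' hw' hlt q r hq hb hr
      have := Set.ncard_lt_ncard hlt (Set.toFinite _)
      exact ih (by omega) hw' hq hb hr
    have hcv : G.CanReach p c v := hc ▸ hq c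
    -- a second cop that can reach `w` walks there while `c` guards `v`
    have second : ∀ {c b : Cop κ} {q : Cop κ → V} {r : V}, (∀ c, G.CanReach p c (q c)) →
        q c = v → r ∈ G.robberLayer.branch v w → b ≠ c → G.CanReach p b w → G.Wins q r := by
      intro c b q r hq hc hr hbc hb
      obtain ⟨l⟩ : (G.copLayer b.1).Reachable (q b) w := (hq b).symm.trans hb
      exact wins_of_walk hR hvw hbc l
        (fun q r hq _ hb hr => wins_of_arrive hR (ih' b) hq (CopTurn.refl G q) hb hr)
        q r hq hc rfl hr
    obtain ⟨hv, hw, hdist⟩ : (∃ c, G.CanReach p c v) ∧ (∃ c, G.CanReach p c w) ∧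
        ∀ c : Cop κ, (∀ c' : Cop κ, G.CanReach p c' v ∨ G.CanReach p c' w → c' = c) →
          (G.copLayer c.1).edist v w < 3 := by
      have hn : ¬ ((∀ c, ¬ G.CanReach p c v) ∨ (∀ c, ¬ G.CanReach p c w) ∨ ∃ c : Cop κ,
          (∀ c' : Cop κ, G.CanReach p c' v ∨ G.CanReach p c' w → c' = c) ∧
            3 ≤ (G.copLayer c.1).edist v w) := fun h => hp ⟨v, w, hvw, h⟩
      push Not at hn
      exact hn
    by_cases hsingle : ∀ c' : Cop κ, G.CanReach p c' v ∨ G.CanReach p c' w → c' = c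
    -- The lone guard gives up `v` for one turn: from `m` it goes on to `w` if the robber stays in
    -- the branch, and back to `v` if the robber steps there.
    · obtain ⟨m, hm₁, hm₂⟩ := SimpleGraph.edist_lt_three_iff.1 (hdist c hsingle)
      have ht : G.CopTurn q (Function.update q c m) := copTurn_update G (hc.symm ▸ hm₁)
      refine Wins.turn ht fun r' hr' => ?_
      rcases hR.mem_branch_or_eq hvw hr hr' with h | rfl
      · exact wins_of_arrive hR (ih' c) (reachable_of_copTurn hq ht)
          (copTurn_update G (c := c) (x := w) (by simpa using hm₂)) (by simp) h
      · refine Wins.catch (copTurn_update G (c := c) (x := r') ?_) c (by simp)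
        rw [Function.update_self]
        exact hm₁.imp Eq.symm SimpleGraph.Adj.symm
    · push Not at hsingle
      obtain ⟨a, ha, hac⟩ := hsingle
      by_cases haw : G.CanReach p a w
      · exact second hq hc hr hac haw
      have hav := ha.resolve_right haw
      obtain ⟨b, hb⟩ := hw
      by_cases hbc : b = c
      · subst hbc
        -- Here the guard is the cop that must go to `w`, so `a` first walks to `v` and replaces it.
        obtain ⟨l⟩ : (G.copLayer a.1).Reachable (q a) v := (hq a).symm.trans hav
        exact wins_of_walk hR hvw hac l
          (fun q r hq _ ha hr => second hq ha hr hac.symm hb) q r hq hc rfl hr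
      · exact second hq hc hr hbc hb

theorem copsWinFrom_of_no_robbersEdge [Finite V] {G : MultiLayerGraph V τ}
    (hR : G.robberLayer.IsTree) {p : Cop κ → V} (c₀ : Cop κ)
    (hp : ¬ ∃ u v : V, G.IsRobbersEdge p u v) : G.CopsWinFrom κ p := by
  refine copsWinFrom_of_forall_wins fun r => ?_
  have hp0 : ∀ c, G.CanReach p c (p c) := fun _ => SimpleGraph.Reachable.refl _
  by_cases hr : p c₀ = r
  · exact Wins.catch (CopTurn.refl G p) c₀ hr
  have : Nontrivial V := ⟨_, _, hr⟩
  -- The walk is empty: the vertex on which `c₀` starts serves as the first guarded vertex.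
  refine wins_of_walk_unguarded (p := p) (b := c₀) .nil (fun q r hq hb => ?_) p r hp0 rfl
  rcases SimpleGraph.exists_mem_branch le_rfl (hR.1.preconnected (p c₀) r) with rfl | ⟨w, hw, hr⟩
  · exact Wins.catch (CopTurn.refl G q) c₀ hb
  · exact wins_of_mem_branch hR.2 hp _ le_rfl hw hq hb hr

/-! ### Evasion on a robber's edge -/

theorem canReach_of_legal {G : MultiLayerGraph V τ} {S : List V → Cop κ → V}
    (hS : G.LegalCopStrategy κ S) (l : List V) (c : Cop κ) : G.CanReach (S []) c (S l c) := by
  induction l using List.reverseRecOn with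
  | nil => exact SimpleGraph.Reachable.refl _
  | append_singleton l v ih =>
    rcases hS l v c with h | h
    · rw [h]; exact ih
    · exact ih.trans h.reachable

theorem not_copsWinFrom_of_robbersEdge {G : MultiLayerGraph V τ} {p : Cop κ → V} {u v : V}
    (h : G.IsRobbersEdge p u v) : ¬ G.CopsWinFrom κ p := by
  classical
  rintro ⟨S, rfl, hS, hwin⟩
  have stay : ∀ x, (∀ c, ¬ G.CanReach (S []) c x) → False := by
    intro x hx
    obtain ⟨t, c, h⟩ := hwin (fun _ => x) fun _ => Or.inl rfl
    obtain ⟨l, hl⟩ : ∃ l, S l c = x := h.elim (fun h => ⟨_, h⟩) fun h => ⟨_, h⟩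
    exact hx c (hl ▸ canReach_of_legal hS l c)
  obtain ⟨huv, h | h | ⟨c, hc, hd⟩⟩ := h
  · exact stay u h
  · exact stay v h
  -- If both ends were within distance 1 of `x`, the triangle inequality would put them at distance
  -- at most 2 from each other.
  let far : V → V := fun x => if 2 ≤ (G.copLayer c.1).edist x u then u else v
  have hfar : ∀ x, 2 ≤ (G.copLayer c.1).edist x (far x) := by
    intro x
    by_cases hx : 2 ≤ (G.copLayer c.1).edist x u
    · simp [far, hx]
    · simp only [far, hx, if_false]
      by_contra hx'
      push Not at hx hx'
      have h1 : (G.copLayer c.1).edist x u ≤ 1 := Order.le_of_lt_add_one hx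
      have h2 : (G.copLayer c.1).edist x v ≤ 1 := Order.le_of_lt_add_one hx'
      have h3 := (G.copLayer c.1).edist_triangle (u := u) (v := x) (w := v)
      rw [SimpleGraph.edist_comm] at h1
      have h4 : (3 : ℕ∞) ≤ 1 + 1 := hd.trans (h3.trans (add_le_add h1 h2))
      exact absurd h4 (by decide)
  -- The robber answers the strategy and the strategy answers the robber, so the history is built
  -- first and the play is read off from it.
  let hist : ℕ → List V := fun t => Nat.rec [] (fun _ l => l ++ [far (S l c)]) t
  let r : ℕ → V := fun t => far (S (hist t) c)
  have hhist : ∀ t, (List.range t).map r = hist t := by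
    intro t
    induction t with
    | zero => rfl
    | succ t ih => rw [List.range_succ, List.map_append, ih]; rfl
  have hmem : ∀ t, r t = u ∨ r t = v := fun t => by
    by_cases hx : 2 ≤ (G.copLayer c.1).edist (S (hist t) c) u
    · left; simp [r, far, hx]
    · right; simp [r, far, hx]
  have hplay : G.LegalRobberPlay r := by
    intro t
    rcases hmem t with h | h <;> rcases hmem (t + 1) with h' | h' <;> rw [h, h']
    · exact Or.inl rfl
    · exact Or.inr huv
    · exact Or.inr huv.symm
    · exact Or.inl rfl
  have key : ∀ (t s : ℕ) (c' : Cop κ), S (hist s) c' = r t → c' = c := by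
    intro t s c' h
    have := canReach_of_legal hS (hist s) c'
    rw [h] at this
    rcases hmem t with h' | h' <;> rw [h'] at this
    · exact hc c' (Or.inl this)
    · exact hc c' (Or.inr this)
  obtain ⟨t, c', h | h⟩ := hwin r hplay
  · rw [copPosition, hhist] at h
    obtain rfl := key t t c' h
    have := hfar (S (hist t) c')
    change 2 ≤ (G.copLayer c'.1).edist _ (r t) at this
    rw [h, SimpleGraph.edist_self] at this
    exact absurd this (by decide)
  · rw [copPosition, hhist] at h
    obtain rfl := key t (t + 1) c' h
    have h2 := hfar (S (hist t) c')
    change 2 ≤ (G.copLayer c'.1).edist _ (r t) at h2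
    rw [← h] at h2
    -- One cop move covers distance at most 1, but the robber was at distance at least 2 before it.
    have h1 : (G.copLayer c'.1).edist (S (hist t) c') (S (hist (t + 1)) c') ≤ 1 := by
      rcases hS (hist t) (far (S (hist t) c')) c' with h | h
      · change (G.copLayer c'.1).edist _ (S (hist t ++ [far (S (hist t) c')]) c') ≤ 1
        rw [h]; simp
      · exact (SimpleGraph.edist_eq_one_iff_adj.2 h).le
    exact absurd (h2.trans h1) (by decide)

theorem copsWinFrom_iff_no_robbersEdge [Finite V] {G : MultiLayerGraph V τ}
    (hκ : 1 ≤ ∑ i, κ i) (hR : G.robberLayer.IsTree) (p : Cop κ → V) :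
    G.CopsWinFrom κ p ↔ ¬ ∃ u v : V, G.IsRobbersEdge p u v := by
  refine ⟨fun h ⟨u, v, huv⟩ => not_copsWinFrom_of_robbersEdge huv h, ?_⟩
  have : Nonempty (Cop κ) := by
    rw [← Fintype.card_pos_iff, Fintype.card_sigma]
    simpa [Nat.one_le_iff_ne_zero, Nat.pos_iff_ne_zero] using hκ
  exact copsWinFrom_of_no_robbersEdge hR this.some

end MultiLayerGraph

/-! ## A language with bounded loops and its compilation -/

namespace RAM

/-- `P` halts from `s` within `C` steps in a state that satisfies `Q`. -/
def Run (P : Prog) (s : State) (C : ℕ) (Q : State → Prop) : Prop :=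
  ∃ t s', Exec P s t s' ∧ t ≤ C ∧ Q s'

namespace Run

variable {P P' : Prog} {s : State} {C C' : ℕ} {Q Q' : State → Prop}

theorem mono (h : Run P s C Q) (hC : C ≤ C') (hQ : ∀ s', Q s' → Q' s') : Run P s C' Q' := by
  obtain ⟨t, s', he, ht, hq⟩ := h
  exact ⟨t, s', he, ht.trans hC, hQ _ hq⟩

theorem seq (h : Run P s C Q) (h' : ∀ s', Q s' → Run P' s' C' Q') :
    Run (.seq P P') s (C + C') Q' := by
  obtain ⟨t, s', he, ht, hq⟩ := h
  obtain ⟨t', s'', he', ht', hq'⟩ := h' s' hq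
  exact ⟨t + t', s'', .seq he he', by omega, hq'⟩

theorem const {x m : ℕ} (h : Q (s.setReg x m)) : Run (.const x m) s 1 Q :=
  ⟨1, _, .const x m s, le_rfl, h⟩

theorem add {x y z : ℕ} (h : Q (s.setReg x (s.reg y + s.reg z))) : Run (.add x y z) s 1 Q :=
  ⟨1, _, .add x y z s, le_rfl, h⟩

theorem sub {x y z : ℕ} (h : Q (s.setReg x (s.reg y - s.reg z))) : Run (.sub x y z) s 1 Q :=
  ⟨1, _, .sub x y z s, le_rfl, h⟩

theorem load {x a y : ℕ} (h : Q (s.setReg x (s.arr a (s.reg y)))) : Run (.load x a y) s 1 Q :=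
  ⟨1, _, .load x a y s, le_rfl, h⟩

theorem store {a y x : ℕ} (h : Q (s.setArr a (s.reg y) (s.reg x))) : Run (.store a y x) s 1 Q :=
  ⟨1, _, .store a y x s, le_rfl, h⟩

theorem const_seq {x m : ℕ} (h : Run P (s.setReg x m) C Q) :
    Run (.seq (.const x m) P) s (1 + C) Q :=
  seq (const (Q := fun s' => s' = s.setReg x m) rfl) fun _ hs => hs ▸ h

theorem add_seq {x y z : ℕ} (h : Run P (s.setReg x (s.reg y + s.reg z)) C Q) :
    Run (.seq (.add x y z) P) s (1 + C) Q :=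
  seq (add (Q := fun s' => s' = s.setReg x (s.reg y + s.reg z)) rfl) fun _ hs => hs ▸ h

theorem ite {x : ℕ} (h : s.reg x ≠ 0 → Run P s C Q) (h' : s.reg x = 0 → Run P' s C' Q) :
    Run (.ite x P P') s (C + C' + 1) Q := by
  by_cases hx : s.reg x = 0
  · obtain ⟨t, s', he, ht, hq⟩ := h' hx
    exact ⟨t + 1, s', .ite_false hx he, by omega, hq⟩
  · obtain ⟨t, s', he, ht, hq⟩ := h hx
    exact ⟨t + 1, s', .ite_true hx he, by omega, hq⟩

end Run

/-- The contents of the variables and of the arrays of a program with bounded loops. -/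
structure Store where
  var : ℕ → ℕ
  arr : ℕ → ℕ → ℕ

/-- Assign `v` to the variable `x`. -/
def Store.setVar (σ : Store) (x v : ℕ) : Store :=
  { σ with var := Function.update σ.var x v }

/-- Write `v` into cell `j` of array `a`. -/
def Store.setArr (σ : Store) (a j v : ℕ) : Store :=
  { σ with arr := Function.update σ.arr a (Function.update (σ.arr a) j v) }

@[simp] theorem Store.setVar_arr (σ : Store) (x v : ℕ) : (σ.setVar x v).arr = σ.arr := rfl
@[simp] theorem Store.setArr_var (σ : Store) (a j v : ℕ) : (σ.setArr a j v).var = σ.var := rfl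

@[simp] theorem Store.setVar_var (σ : Store) (x v y : ℕ) :
    (σ.setVar x v).var y = if y = x then v else σ.var y := Function.update_apply _ _ _ _

theorem Store.setArr_arr (σ : Store) (a j v b i : ℕ) :
    (σ.setArr a j v).arr b i = if b = a ∧ i = j then v else σ.arr b i := by
  by_cases hb : b = a
  · subst hb
    by_cases hi : i = j <;> simp [Store.setArr, hi]
  · simp [Store.setArr, hb]

/-- Expressions. Parameters are never assigned to; `sum x p e` is the sum of `e` over all values of
the variable `x` below the parameter `p`. -/
inductive Exp : Type
  | const (m : ℕ)
  | prm (p : ℕ)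
  | var (x : ℕ)
  | add (a b : Exp)
  | sub (a b : Exp)
  | load (a : ℕ) (e : Exp)
  | ite (a b c : Exp)
  | sum (x p : ℕ) (e : Exp)

/-- Commands. `loop x p c` executes `c` for all values of the variable `x` below the parameter
`p`. -/
inductive Cmd : Type
  | assign (x : ℕ) (e : Exp)
  | store (a : ℕ) (j e : Exp)
  | seq (c c' : Cmd)
  | loop (x p : ℕ) (c : Cmd)

/-- The value of an expression, if the parameters have the values `ρ`. -/
def Exp.eval (ρ : ℕ → ℕ) : Exp → Store → ℕ
  | const m, _ => m
  | prm p, _ => ρ p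
  | var x, σ => σ.var x
  | add a b, σ => a.eval ρ σ + b.eval ρ σ
  | sub a b, σ => a.eval ρ σ - b.eval ρ σ
  | load a e, σ => σ.arr a (e.eval ρ σ)
  | ite a b c, σ => if a.eval ρ σ ≠ 0 then b.eval ρ σ else c.eval ρ σ
  | sum x p e, σ => ∑ j ∈ Finset.range (ρ p), e.eval ρ (σ.setVar x j)

/-- The effect of a command, if the parameters have the values `ρ`. -/
def Cmd.run (ρ : ℕ → ℕ) : Cmd → Store → Store
  | assign x e, σ => σ.setVar x (e.eval ρ σ)
  | store a j e, σ => σ.setArr a (j.eval ρ σ) (e.eval ρ σ)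
  | seq c c', σ => c'.run ρ (c.run ρ σ)
  | loop x p c, σ => Nat.rec σ (fun j σ' => c.run ρ (σ'.setVar x j)) (ρ p)

theorem Cmd.run_loop_of_inv {ρ : ℕ → ℕ} {x p : ℕ} {c : Cmd} (I : ℕ → Store → Prop) {σ : Store}
    (h0 : I 0 σ) (h : ∀ j < ρ p, ∀ σ, I j σ → I (j + 1) (c.run ρ (σ.setVar x j))) :
    I (ρ p) ((Cmd.loop x p c).run ρ σ) := by
  have : ∀ m ≤ ρ p, I m (Nat.rec σ (fun j σ' => c.run ρ (σ'.setVar x j)) m) := by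
    intro m
    induction m with
    | zero => exact fun _ => h0
    | succ m ih => exact fun hm => h m hm _ (ih (by omega))
  exact this _ le_rfl

/-- If every pass `j` of a loop makes the goal `Q j` true, and changes the store only along a
transitive relation `R` that preserves the goals, then all goals are true after the loop. -/
theorem Cmd.run_loop_of_rel {ρ : ℕ → ℕ} {x p : ℕ} {c : Cmd} (R : Store → Store → Prop)
    (hrefl : ∀ σ, R σ σ) (htrans : ∀ {σ σ' σ''}, R σ σ' → R σ' σ'' → R σ σ'')
    (Q : ℕ → Store → Prop) (hQ : ∀ {j σ σ'}, Q j σ → R σ σ' → Q j σ') {σ : Store}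
    (h : ∀ j < ρ p, ∀ σ', R σ σ' →
      R σ' (c.run ρ (σ'.setVar x j)) ∧ Q j (c.run ρ (σ'.setVar x j))) :
    R σ ((Cmd.loop x p c).run ρ σ) ∧ ∀ j < ρ p, Q j ((Cmd.loop x p c).run ρ σ) :=
  Cmd.run_loop_of_inv (I := fun m σ' => R σ σ' ∧ ∀ j < m, Q j σ')
    ⟨hrefl σ, fun _ h => absurd h (Nat.not_lt_zero _)⟩ fun j hj σ' ⟨hR, hq⟩ => by
      obtain ⟨h1, h2⟩ := h j hj σ' hR
      refine ⟨htrans hR h1, fun i hi => ?_⟩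
      rcases Nat.lt_succ_iff_lt_or_eq.1 hi with hi | rfl
      · exact hQ (hq i hi) h1
      · exact h2

/-- The register of a parameter. -/
def prmReg (p : ℕ) : ℕ := 3 * p
/-- The register of a variable. -/
def varReg (x : ℕ) : ℕ := 3 * x + 1
/-- The registers for intermediate results. -/
def tmpReg (d : ℕ) : ℕ := 3 * d + 2

@[simp] theorem tmpReg_inj {d d' : ℕ} : tmpReg d = tmpReg d' ↔ d = d' := by
  simp [tmpReg]
@[simp] theorem varReg_inj {x y : ℕ} : varReg x = varReg y ↔ x = y := by
  simp [varReg]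
@[simp] theorem prmReg_ne_varReg (p x : ℕ) : prmReg p ≠ varReg x := by
  simp only [prmReg, varReg]; omega
@[simp] theorem prmReg_ne_tmpReg (p d : ℕ) : prmReg p ≠ tmpReg d := by
  simp only [prmReg, tmpReg]; omega
@[simp] theorem varReg_ne_tmpReg (x d : ℕ) : varReg x ≠ tmpReg d := by
  simp only [varReg, tmpReg]; omega
@[simp] theorem tmpReg_ne_varReg (x d : ℕ) : tmpReg d ≠ varReg x := (varReg_ne_tmpReg x d).symm

@[simp] theorem State.setReg_arr (s : State) (x v : ℕ) : (s.setReg x v).arr = s.arr := rfl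
@[simp] theorem State.setArr_reg (s : State) (a j v : ℕ) : (s.setArr a j v).reg = s.reg := rfl
@[simp] theorem State.setReg_reg (s : State) (x v y : ℕ) :
    (s.setReg x v).reg y = if y = x then v else s.reg y := Function.update_apply _ _ _ _

/-- The machine state `s` represents the parameters `ρ` and the store `σ`. -/
structure Sim (ρ : ℕ → ℕ) (σ : Store) (s : State) : Prop where
  prm : ∀ p, s.reg (prmReg p) = ρ p
  var : ∀ x, s.reg (varReg x) = σ.var x
  arr : s.arr = σ.arr

namespace Sim

variable {ρ : ℕ → ℕ} {σ : Store} {s : State}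

theorem setTmp (h : Sim ρ σ s) (d v : ℕ) : Sim ρ σ (s.setReg (tmpReg d) v) :=
  ⟨fun p => by simp [h.prm], fun x => by simp [h.var], h.arr⟩

theorem setVar (h : Sim ρ σ s) (x v : ℕ) : Sim ρ (σ.setVar x v) (s.setReg (varReg x) v) :=
  ⟨fun p => by simp [h.prm], fun y => by simp [h.var], h.arr⟩

theorem setArr (h : Sim ρ σ s) (a j v : ℕ) : Sim ρ (σ.setArr a j v) (s.setArr a j v) :=
  ⟨h.prm, h.var, by simp [State.setArr, Store.setArr, h.arr]⟩

end Sim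

/-- Run `body` for all values of the variable `x` below the parameter `p`. -/
def forProg (p x d : ℕ) (body : Prog) : Prog :=
  .seq (.const (tmpReg d) 0) <|
  .seq (.add (tmpReg (d + 1)) (prmReg p) (tmpReg d)) <|
  .seq (.const (tmpReg (d + 2)) 0) <|
  .seq (.const (tmpReg (d + 3)) 1) <|
  .loop (tmpReg (d + 1)) <|
  .seq (.add (varReg x) (tmpReg (d + 2)) (tmpReg d)) <|
  .seq body <|
  .seq (.add (tmpReg (d + 2)) (tmpReg (d + 2)) (tmpReg (d + 3)))
    (.sub (tmpReg (d + 1)) (tmpReg (d + 1)) (tmpReg (d + 3)))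

/-- The registers `tmpReg d` to `tmpReg (d + 3)` hold 0, the number of passes left, the index and 1.
The invariant must not depend on them, and the body must preserve them. Each pass costs 4 steps
beyond the body: the test, the copy of the index and two updates. -/
theorem run_forProg {p x d C : ℕ} {body : Prog} (I : ℕ → State → Prop) {s : State} (h0 : I 0 s)
    (htmp : ∀ j s i v, i < 4 → I j s → I j (s.setReg (tmpReg (d + i)) v))
    (hbody : ∀ j < s.reg (prmReg p), ∀ s', I j s' →
      Run body (s'.setReg (varReg x) j) C fun s'' => I (j + 1) s'' ∧
        ∀ i < 4, s''.reg (tmpReg (d + i)) = s'.reg (tmpReg (d + i))) :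
    Run (forProg p x d body) s (5 + s.reg (prmReg p) * (C + 4)) (I (s.reg (prmReg p))) := by
  have hloop : ∀ r j s', r + j = s.reg (prmReg p) → I j s' → s'.reg (tmpReg d) = 0 →
      s'.reg (tmpReg (d + 1)) = r → s'.reg (tmpReg (d + 2)) = j → s'.reg (tmpReg (d + 3)) = 1 →
      Run (.loop (tmpReg (d + 1)) <|
        .seq (.add (varReg x) (tmpReg (d + 2)) (tmpReg d)) <|
        .seq body <|
        .seq (.add (tmpReg (d + 2)) (tmpReg (d + 2)) (tmpReg (d + 3)))
          (.sub (tmpReg (d + 1)) (tmpReg (d + 1)) (tmpReg (d + 3)))) s' (1 + r * (C + 4))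
        (I (s.reg (prmReg p))) := by
    intro r
    induction r with
    | zero =>
      intro j s' hj hI _ h1 _ _
      rw [zero_add] at hj
      exact ⟨1, s', .loop_done h1, by omega, hj ▸ hI⟩
    | succ r ih =>
      intro j s' hj hI h0 h1 h2 h3
      have hb := hbody j (by omega) s' hI
      have step : Run (.seq (.add (varReg x) (tmpReg (d + 2)) (tmpReg d)) <|
          .seq body <|
          .seq (.add (tmpReg (d + 2)) (tmpReg (d + 2)) (tmpReg (d + 3)))
            (.sub (tmpReg (d + 1)) (tmpReg (d + 1)) (tmpReg (d + 3)))) s' (1 + (C + (1 + 1)))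
          fun s'' => I (j + 1) s'' ∧ s''.reg (tmpReg d) = 0 ∧ s''.reg (tmpReg (d + 1)) = r ∧
            s''.reg (tmpReg (d + 2)) = j + 1 ∧ s''.reg (tmpReg (d + 3)) = 1 := by
        refine Run.seq (Run.add (Q := fun s'' => s'' = s'.setReg (varReg x) j) (by simp [h0, h2]))
          fun s₁ hs₁ => ?_
        subst hs₁
        refine Run.seq hb fun s₂ ⟨hI₂, hk⟩ => ?_
        have k0 := hk 0 (by omega)
        have k1 := hk 1 (by omega)
        have k2 := hk 2 (by omega)
        have k3 := hk 3 (by omega)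
        simp only [add_zero] at k0
        refine Run.seq (Run.add (Q := fun s'' => s'' = s₂.setReg (tmpReg (d + 2)) (j + 1))
          (by simp [k2, k3, h2, h3])) fun s₃ hs₃ => ?_
        subst hs₃
        refine Run.sub ⟨htmp _ _ 1 _ (by omega) (htmp _ _ 2 _ (by omega) hI₂), ?_⟩
        simp [k0, k1, k3, h0, h1, h3]
      obtain ⟨t, s'', he, ht, hI'', g0, g1, g2, g3⟩ := step
      obtain ⟨t', s₃, he', ht', hq⟩ := ih (j + 1) s'' (by omega) hI'' g0 g1 g2 g3
      refine ⟨t + t' + 1, s₃, .loop_step (by omega) he he', ?_, hq⟩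
      rw [Nat.succ_mul]
      omega
  have hC : 5 + s.reg (prmReg p) * (C + 4) =
      1 + (1 + (1 + (1 + (1 + s.reg (prmReg p) * (C + 4))))) := by omega
  rw [hC]
  refine Run.const_seq (Run.add_seq (Run.const_seq (Run.const_seq ?_)))
  simp only [State.setReg_reg, prmReg_ne_tmpReg, if_false, if_true, add_zero]
  refine hloop _ 0 _ (add_zero _) ?_ (by simp) (by simp) (by simp) (by simp)
  exact htmp _ _ 3 _ (by omega) <| htmp _ _ 2 _ (by omega) <| htmp _ _ 1 _ (by omega) <|
    htmp _ _ 0 _ (by omega) h0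

/-- A program that computes the value of an expression in register `tmpReg d`. -/
def Exp.compile : Exp → ℕ → Prog
  | const m, d => .const (tmpReg d) m
  | prm p, d => .seq (.const (tmpReg d) 0) (.add (tmpReg d) (prmReg p) (tmpReg d))
  | var x, d => .seq (.const (tmpReg d) 0) (.add (tmpReg d) (varReg x) (tmpReg d))
  | add a b, d => .seq (a.compile d) <| .seq (b.compile (d + 1)) <|
      .add (tmpReg d) (tmpReg d) (tmpReg (d + 1))
  | sub a b, d => .seq (a.compile d) <| .seq (b.compile (d + 1)) <|
      .sub (tmpReg d) (tmpReg d) (tmpReg (d + 1))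
  | load a e, d => .seq (e.compile d) (.load (tmpReg d) a (tmpReg d))
  | ite a b c, d => .seq (a.compile d) (.ite (tmpReg d) (b.compile d) (c.compile d))
  | sum x p e, d =>
      .seq (.const (tmpReg d) 0) <|
      .seq (.add (tmpReg (d + 1)) (varReg x) (tmpReg d)) <|
      .seq (forProg p x (d + 2) <|
        .seq (e.compile (d + 6)) (.add (tmpReg d) (tmpReg d) (tmpReg (d + 6)))) <|
      .seq (.const (tmpReg (d + 2)) 0) <|
      .add (varReg x) (tmpReg (d + 1)) (tmpReg (d + 2))

/-- A bound for the number of steps of `Exp.compile`. -/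
def Exp.cost (ρ : ℕ → ℕ) : Exp → ℕ
  | const _ => 1
  | prm _ => 2
  | var _ => 2
  | add a b => a.cost ρ + (b.cost ρ + 1)
  | sub a b => a.cost ρ + (b.cost ρ + 1)
  | load _ e => e.cost ρ + 1
  | ite a b c => a.cost ρ + (b.cost ρ + c.cost ρ + 1)
  | sum _ p e => 1 + (1 + ((5 + ρ p * (e.cost ρ + 1 + 4)) + (1 + 1)))

/-- Temporaries below `d` act as a stack that the evaluation leaves alone; this is what lets the
induction combine subexpressions. -/
theorem Exp.run_compile (ρ : ℕ → ℕ) (e : Exp) (d : ℕ) (σ : Store) (s : State)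
    (h : Sim ρ σ s) : Run (e.compile d) s (e.cost ρ) fun s' => Sim ρ σ s' ∧
      (∀ i < d, s'.reg (tmpReg i) = s.reg (tmpReg i)) ∧ s'.reg (tmpReg d) = e.eval ρ σ := by
  induction e generalizing d σ s with
  | const m =>
    exact Run.const ⟨h.setTmp _ _, fun i hi => by simp [hi.ne], by simp [Exp.eval]⟩
  | prm p =>
    exact Run.const_seq <| Run.add ⟨(h.setTmp _ _).setTmp _ _, fun i hi => by simp [hi.ne],
      by simp [Exp.eval, h.prm]⟩
  | var x =>
    exact Run.const_seq <| Run.add ⟨(h.setTmp _ _).setTmp _ _, fun i hi => by simp [hi.ne],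
      by simp [Exp.eval, h.var]⟩
  | add a b iha ihb =>
    refine Run.seq (iha d σ s h) fun s₁ ⟨h₁, k₁, v₁⟩ => ?_
    refine Run.seq (ihb (d + 1) σ s₁ h₁) fun s₂ ⟨h₂, k₂, v₂⟩ => ?_
    refine Run.add ⟨h₂.setTmp _ _, fun i hi => ?_, ?_⟩
    · simp [hi.ne, k₂ i (by omega), k₁ i hi]
    · simp [Exp.eval, k₂ d (by omega), v₁, v₂]
  | sub a b iha ihb =>
    refine Run.seq (iha d σ s h) fun s₁ ⟨h₁, k₁, v₁⟩ => ?_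
    refine Run.seq (ihb (d + 1) σ s₁ h₁) fun s₂ ⟨h₂, k₂, v₂⟩ => ?_
    refine Run.sub ⟨h₂.setTmp _ _, fun i hi => ?_, ?_⟩
    · simp [hi.ne, k₂ i (by omega), k₁ i hi]
    · simp [Exp.eval, k₂ d (by omega), v₁, v₂]
  | load a e ih =>
    refine Run.seq (ih d σ s h) fun s₁ ⟨h₁, k₁, v₁⟩ => ?_
    refine Run.load ⟨h₁.setTmp _ _, fun i hi => ?_, ?_⟩
    · simp [hi.ne, k₁ i hi]
    · simp [Exp.eval, v₁, h₁.arr]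
  | ite a b c iha ihb ihc =>
    refine Run.seq (iha d σ s h) fun s₁ ⟨h₁, k₁, v₁⟩ => ?_
    refine Run.ite (fun hx => ?_) fun hx => ?_
    · refine (ihb d σ s₁ h₁).mono le_rfl fun s₂ ⟨h₂, k₂, v₂⟩ =>
        ⟨h₂, fun i hi => (k₂ i hi).trans (k₁ i hi), ?_⟩
      rw [v₂, Exp.eval, if_pos (by rwa [← v₁])]
    · refine (ihc d σ s₁ h₁).mono le_rfl fun s₂ ⟨h₂, k₂, v₂⟩ =>
        ⟨h₂, fun i hi => (k₂ i hi).trans (k₁ i hi), ?_⟩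
      rw [v₂, Exp.eval, if_neg (by rwa [← v₁, not_not])]
  | sum x p e ih =>
    refine Run.const_seq (Run.add_seq ?_)
    generalize hs₂ : (s.setReg (tmpReg d) 0).setReg _ _ = s₂
    simp only [State.setReg_reg, varReg_ne_tmpReg, if_false, if_true, add_zero, h.var] at hs₂
    have hp : s₂.reg (prmReg p) = ρ p := by simp [← hs₂, h.prm]
    -- During the summation `x` has some unspecified value; the original one waits in `tmpReg (d +
    -- 1)` and is restored at the end, so that expressions have no side effects.
    let I : ℕ → State → Prop := fun j s' => (∃ v, Sim ρ (σ.setVar x v) s') ∧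
      (∀ i < d, s'.reg (tmpReg i) = s.reg (tmpReg i)) ∧
      s'.reg (tmpReg d) = ∑ i ∈ Finset.range j, e.eval ρ (σ.setVar x i) ∧
      s'.reg (tmpReg (d + 1)) = σ.var x
    have hI0 : I 0 s₂ := by
      refine ⟨⟨σ.var x, ?_⟩, fun i hi => ?_, ?_, ?_⟩
      · have : σ.setVar x (σ.var x) = σ := by simp [Store.setVar]
        rw [this, ← hs₂]
        exact (h.setTmp _ _).setTmp _ _
      · simp [← hs₂, hi.ne, (hi.trans (Nat.lt_succ_self d)).ne]
      · simp [← hs₂]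
      · simp [← hs₂]
    have hfor := run_forProg (p := p) (x := x) (d := d + 2) (C := e.cost ρ + 1)
      (body := .seq (e.compile (d + 6)) (.add (tmpReg d) (tmpReg d) (tmpReg (d + 6)))) I hI0
      (by
        rintro j s' i v - ⟨⟨w, h1⟩, h2, h3, h4⟩
        refine ⟨⟨w, h1.setTmp _ _⟩, fun i' hi' => ?_, ?_, ?_⟩
        · simp [h2 i' hi', show i' ≠ d + 2 + i by omega]
        · simp [h3, show d ≠ d + 2 + i by omega]
        · simp [h4, show d + 1 ≠ d + 2 + i by omega])
      (by
        rintro j - s' ⟨⟨w, h1⟩, h2, h3, h4⟩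
        have hsv : (σ.setVar x w).setVar x j = σ.setVar x j := by simp [Store.setVar]
        have h1' := h1.setVar x j
        rw [hsv] at h1'
        refine Run.seq (ih (d + 6) _ _ h1') fun s₃ ⟨g1, g2, g3⟩ => ?_
        refine Run.add ⟨⟨⟨j, g1.setTmp _ _⟩, fun i hi => ?_, ?_, ?_⟩, fun i hi => ?_⟩
        · simp [hi.ne, g2 i (by omega), h2 i hi]
        · simp [g2 d (by omega), h3, g3, Finset.sum_range_succ]
        · simp [g2 (d + 1) (by omega), h4]
        · simp [show d + 2 + i ≠ d by omega, g2 (d + 2 + i) (by omega)])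
    rw [hp] at hfor
    refine Run.seq hfor fun s₃ ⟨⟨w, h1⟩, h2, h3, h4⟩ => ?_
    refine Run.const_seq ?_
    have hsv : (σ.setVar x w).setVar x (σ.var x) = σ := by simp [Store.setVar]
    refine Run.add ⟨?_, fun i hi => ?_, ?_⟩
    · have := (h1.setTmp (d + 2) 0).setVar x (σ.var x)
      rw [hsv] at this
      simpa [h4] using this
    · simp [h2 i hi, show i ≠ d + 2 by omega]
    · simp [h3, Exp.eval]

/-- A program with the effect of a command; it uses the registers `tmpReg i` with `d ≤ i`. -/
def Cmd.compile : Cmd → ℕ → Prog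
  | assign x e, d => .seq (e.compile d) <| .seq (.const (tmpReg (d + 1)) 0) <|
      .add (varReg x) (tmpReg d) (tmpReg (d + 1))
  | store a j e, d => .seq (j.compile d) <| .seq (e.compile (d + 1)) <|
      .store a (tmpReg d) (tmpReg (d + 1))
  | seq c c', d => .seq (c.compile d) (c'.compile d)
  | loop x p c, d => forProg p x d (c.compile (d + 4))

/-- A bound for the number of steps of `Cmd.compile`. -/
def Cmd.cost (ρ : ℕ → ℕ) : Cmd → ℕ
  | assign _ e => e.cost ρ + (1 + 1)
  | store _ j e => j.cost ρ + (e.cost ρ + 1)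
  | seq c c' => c.cost ρ + c'.cost ρ
  | loop _ p c => 5 + ρ p * (c.cost ρ + 4)

theorem Cmd.run_compile (ρ : ℕ → ℕ) (c : Cmd) (d : ℕ) (σ : Store) (s : State)
    (h : Sim ρ σ s) : Run (c.compile d) s (c.cost ρ) fun s' => Sim ρ (c.run ρ σ) s' ∧
      ∀ i < d, s'.reg (tmpReg i) = s.reg (tmpReg i) := by
  induction c generalizing d σ s with
  | assign x e =>
    refine Run.seq (e.run_compile ρ d σ s h) fun s₁ ⟨h₁, k₁, v₁⟩ => ?_
    refine Run.const_seq (Run.add ⟨?_, fun i hi => ?_⟩)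
    · have := (h₁.setTmp (d + 1) 0).setVar x (e.eval ρ σ)
      simpa [v₁, Cmd.run] using this
    · simp [k₁ i hi, show i ≠ d + 1 by omega]
  | store a j e =>
    refine Run.seq (j.run_compile ρ d σ s h) fun s₁ ⟨h₁, k₁, v₁⟩ => ?_
    refine Run.seq (e.run_compile ρ (d + 1) σ s₁ h₁) fun s₂ ⟨h₂, k₂, v₂⟩ => ?_
    refine Run.store ⟨?_, fun i hi => ?_⟩
    · rw [k₂ d (by omega), v₁, v₂]
      exact h₂.setArr _ _ _
    · simp [k₂ i (by omega), k₁ i hi]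
  | seq c c' ih ih' =>
    refine Run.seq (ih d σ s h) fun s₁ ⟨h₁, k₁⟩ => ?_
    exact (ih' d _ s₁ h₁).mono le_rfl fun s₂ ⟨h₂, k₂⟩ =>
      ⟨h₂, fun i hi => (k₂ i hi).trans (k₁ i hi)⟩
  | loop x p c ih =>
    have hfor := run_forProg (p := p) (x := x) (d := d) (C := c.cost ρ)
      (body := c.compile (d + 4))
      (fun j s' => Sim ρ (Nat.rec σ (fun j σ' => c.run ρ (σ'.setVar x j)) j) s' ∧
        ∀ i < d, s'.reg (tmpReg i) = s.reg (tmpReg i)) ⟨h, fun _ _ => rfl⟩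
      (by
        rintro j s' i v - ⟨h1, h2⟩
        refine ⟨h1.setTmp _ _, fun i' hi' => ?_⟩
        simp [h2 i' hi', show i' ≠ d + i by omega])
      (by
        rintro j - s' ⟨h1, h2⟩
        refine (ih (d + 4) _ _ (h1.setVar x j)).mono le_rfl fun s₃ ⟨g1, g2⟩ =>
          ⟨⟨g1, fun i hi => ?_⟩, fun i hi => ?_⟩
        · simp [g2 i (by omega), h2 i hi]
        · simp [g2 (d + i) (by omega)])
    rw [h.prm] at hfor
    exact hfor

/-- `f` is bounded by a power of any common bound of `2` and the parameters. -/
def PowBounded (f : (ℕ → ℕ) → ℕ) : Prop :=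
  ∃ N, ∀ (B : ℕ) (ρ : ℕ → ℕ), 2 ≤ B → (∀ p, ρ p ≤ B) → f ρ ≤ B ^ N

namespace PowBounded

variable {f g : (ℕ → ℕ) → ℕ}

theorem const (m : ℕ) : PowBounded fun _ => m :=
  ⟨m, fun _ _ hB _ => (Nat.lt_pow_self hB).le⟩

theorem prm (p : ℕ) : PowBounded fun ρ => ρ p :=
  ⟨1, fun B ρ _ h => by simpa using h p⟩

theorem mul (hf : PowBounded f) (hg : PowBounded g) : PowBounded fun ρ => f ρ * g ρ := by
  obtain ⟨M, hM⟩ := hf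
  obtain ⟨N, hN⟩ := hg
  exact ⟨M + N, fun B ρ hB h => by
    rw [pow_add]
    exact Nat.mul_le_mul (hM B ρ hB h) (hN B ρ hB h)⟩

theorem add (hf : PowBounded f) (hg : PowBounded g) : PowBounded fun ρ => f ρ + g ρ := by
  obtain ⟨M, hM⟩ := hf
  obtain ⟨N, hN⟩ := hg
  refine ⟨M + N + 1, fun B ρ hB h => ?_⟩
  have h1 : f ρ ≤ B ^ (M + N) :=
    (hM B ρ hB h).trans (Nat.pow_le_pow_right (by omega) (by omega))
  have h2 : g ρ ≤ B ^ (M + N) :=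
    (hN B ρ hB h).trans (Nat.pow_le_pow_right (by omega) (by omega))
  calc f ρ + g ρ ≤ B ^ (M + N) * 2 := by omega
    _ ≤ B ^ (M + N + 1) := Nat.mul_le_mul_left _ hB

end PowBounded

/-- For a fixed expression the cost is built from constants and parameters by finitely many sums and
products. -/
theorem Exp.powBounded_cost (e : Exp) : PowBounded fun ρ => e.cost ρ := by
  induction e with
  | const | prm | var => exact .const _
  | add _ _ iha ihb | sub _ _ iha ihb => exact iha.add (ihb.add (.const 1))
  | load _ _ ih => exact ih.add (.const 1)
  | ite _ _ _ iha ihb ihc => exact iha.add ((ihb.add ihc).add (.const 1))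
  | sum _ p _ ih =>
    exact .add (.const 1) (.add (.const 1) (.add (.add (.const 5)
      (.mul (.prm p) ((ih.add (.const 1)).add (.const 4)))) (.const 2)))

theorem Cmd.powBounded_cost (c : Cmd) : PowBounded fun ρ => c.cost ρ := by
  induction c with
  | assign _ e => exact e.powBounded_cost.add (.const 2)
  | store _ j e => exact j.powBounded_cost.add (e.powBounded_cost.add (.const 1))
  | seq _ _ ih ih' => exact ih.add ih'
  | loop _ p _ ih => exact .add (.const 5) (.mul (.prm p) (ih.add (.const 4)))

end RAM

/-! ## The search for a placement -/

namespace MultiLayerGraph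

variable {V : Type*} {τ : ℕ}

/-- A cop in layer `c.1` on the vertex `c.2` can reach `v`. -/
def Reaches (G : MultiLayerGraph V τ) (c : Fin τ × V) (v : V) : Prop :=
  (G.copLayer c.1).Reachable c.2 v

open Classical in
/-- The contribution of a cop to the defence of the edge `uv`; a total of `2` is needed. -/
noncomputable def weight (G : MultiLayerGraph V τ) (u v : V) (c : Fin τ × V) : ℕ :=
  if G.Reaches c u ∨ G.Reaches c v then if (G.copLayer c.1).edist u v < 3 then 2 else 1 else 0

/-- The cops in `cs` prevent the edge `uv` from being a robber's edge. -/
def Secure (G : MultiLayerGraph V τ) (cs : List (Fin τ × V)) (u v : V) : Prop :=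
  (∃ c ∈ cs, G.Reaches c u) ∧ (∃ c ∈ cs, G.Reaches c v) ∧ 2 ≤ (cs.map (G.weight u v)).sum

/-- There is no robber's edge for the cops in `cs`. -/
def Solves (G : MultiLayerGraph V τ) (cs : List (Fin τ × V)) : Prop :=
  ∀ u v, G.robberLayer.Adj u v → G.Secure cs u v

variable {G : MultiLayerGraph V τ}

theorem weight_eq_zero {u v : V} {c : Fin τ × V} :
    G.weight u v c = 0 ↔ ¬ (G.Reaches c u ∨ G.Reaches c v) := by
  unfold weight
  split_ifs <;> simp_all

/-- The bridge between the cops of an allocation and a list of cops, in which repetitions count. -/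
theorem secure_iff_sum {ι : Type*} [Fintype ι] (cs : List (Fin τ × V)) (e : ι ≃ Fin cs.length)
    (g : ι → Fin τ × V) (hg : ∀ i, cs.get (e i) = g i) (u v : V) :
    G.Secure cs u v ↔ (∃ i, G.Reaches (g i) u) ∧ (∃ i, G.Reaches (g i) v) ∧
      2 ≤ ∑ i, G.weight u v (g i) := by
  have hex : ∀ P : Fin τ × V → Prop, (∃ c ∈ cs, P c) ↔ ∃ i, P (g i) := fun P => by
    constructor
    · rintro ⟨c, hc, hP⟩
      obtain ⟨j, rfl⟩ := List.mem_iff_get.1 hc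
      exact ⟨e.symm j, by rw [← hg]; simpa using hP⟩
    · rintro ⟨i, hP⟩
      exact ⟨g i, hg i ▸ List.get_mem _ _, hP⟩
  have hsum : (cs.map (G.weight u v)).sum = ∑ i, G.weight u v (g i) := by
    simp only [← hg]
    rw [e.sum_comp fun j => G.weight u v (cs.get j), ← List.sum_ofFn]
    congr 1
    conv_lhs => rw [← List.ofFn_get cs, List.map_ofFn]
    rfl
  rw [Secure, hex, hex, hsum]

/-- When both ends are reached, weight at least 2 comes either from two cops or from one cop for
which the ends are near; if just one cop reaches the edge, the sum is its weight. -/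
theorem isRobbersEdge_iff {κ : Fin τ → ℕ} {p : Cop κ → V} {u v : V} :
    G.IsRobbersEdge p u v ↔ G.robberLayer.Adj u v ∧
      ¬ ((∃ c : Cop κ, G.Reaches (c.1, p c) u) ∧ (∃ c : Cop κ, G.Reaches (c.1, p c) v) ∧
        2 ≤ ∑ c : Cop κ, G.weight u v (c.1, p c)) := by
  classical
  rw [IsRobbersEdge]
  refine and_congr_right fun _ => ?_
  rw [← not_iff_not, not_not]
  push Not
  refine and_congr_right fun ⟨a, ha⟩ => and_congr_right fun _ => ⟨fun h => ?_, fun h c hc => ?_⟩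
  · have hsub : ∀ S : Finset (Cop κ), ∑ c ∈ S, G.weight u v (c.1, p c) ≤
        ∑ c : Cop κ, G.weight u v (c.1, p c) := fun S =>
      Finset.sum_le_sum_of_subset (Finset.subset_univ S)
    by_cases hs : ∀ c' : Cop κ, G.CanReach p c' u ∨ G.CanReach p c' v → c' = a
    · refine le_trans ?_ (hsub {a})
      have ha' : G.Reaches (a.1, p a) u := ha
      simp [weight, ha', h a hs]
    · push Not at hs
      obtain ⟨b, hb, hba⟩ := hs
      refine le_trans ?_ (hsub {a, b})
      have h1 : G.weight u v (a.1, p a) ≠ 0 := fun h0 => weight_eq_zero.1 h0 (Or.inl ha)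
      have h2 : G.weight u v (b.1, p b) ≠ 0 := fun h0 => weight_eq_zero.1 h0 hb
      rw [Finset.sum_pair hba.symm]
      omega
  · rw [Finset.sum_eq_single c] at h
    · by_contra hlt
      rw [weight, if_neg hlt] at h
      split_ifs at h <;> omega
    · intro b _ hbc
      exact weight_eq_zero.2 fun hb => hbc (hc b hb)
    · exact fun h => absurd (Finset.mem_univ c) h

theorem multiLayerCopsAndRobber_iff [Finite V] (hR : G.robberLayer.IsTree) {k : ℕ} (hk : 1 ≤ k) :
    G.MultiLayerCopsAndRobber k ↔ ∃ cs, cs.length = k ∧ G.Solves cs := by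
  classical
  constructor
  · rintro ⟨κ, hκ, p, hp⟩
    rw [copsWinFrom_iff_no_robbersEdge (hκ ▸ hk) hR] at hp
    have hcard : Fintype.card (Cop κ) = k := by simpa using hκ
    let e : Cop κ ≃ Fin k := Fintype.equivFinOfCardEq hcard
    refine ⟨List.ofFn fun i => ((e.symm i).1, p (e.symm i)), by simp, fun u v huv => ?_⟩
    rw [secure_iff_sum _ (e.trans (finCongr (by simp))) (fun c => (c.1, p c)) (by simp)]
    by_contra h
    exact hp ⟨u, v, isRobbersEdge_iff.2 ⟨huv, h⟩⟩
  · rintro ⟨cs, rfl, hcs⟩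
    let g : Fin cs.length → Fin τ := fun j => (cs.get j).1
    -- The allocation is recovered by counting the list entries in each layer.
    let κ : Fin τ → ℕ := fun i => Fintype.card {j // g j = i}
    let e : Cop κ ≃ Fin cs.length :=
      (Equiv.sigmaCongrRight fun i => (Fintype.equivFin {j // g j = i}).symm).trans
        (Equiv.sigmaFiberEquiv g)
    have he : ∀ c : Cop κ, (cs.get (e c)).1 = c.1 := fun c =>
      ((Fintype.equivFin {j // g j = c.1}).symm c.2).2
    have hκ : ∑ i, κ i = cs.length := by
      have := Fintype.card_congr e
      simpa using this
    refine ⟨κ, hκ, fun c => (cs.get (e c)).2, ?_⟩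
    rw [copsWinFrom_iff_no_robbersEdge (hκ ▸ hk) hR]
    rintro ⟨u, v, huv⟩
    obtain ⟨hadj, hn⟩ := isRobbersEdge_iff.1 huv
    refine hn ((secure_iff_sum cs e (fun c => (c.1, (cs.get (e c)).2)) (fun c => ?_) u v).1
      (hcs u v hadj))
    exact Prod.ext (he c) rfl

/-! ### The bounded search tree -/

theorem Secure.append {cs : List (Fin τ × V)} {u v : V} (h : G.Secure cs u v)
    (ds : List (Fin τ × V)) : G.Secure (cs ++ ds) u v := by
  obtain ⟨⟨a, ha, ha'⟩, ⟨b, hb, hb'⟩, h⟩ := h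
  refine ⟨⟨a, List.mem_append_left _ ha, ha'⟩, ⟨b, List.mem_append_left _ hb, hb'⟩, ?_⟩
  rw [List.map_append, List.sum_append]
  omega

/-- Cops that reach neither end contribute no reachability and no weight, so they cannot repair the
edge. -/
theorem exists_reaches_of_secure_append {cs ds : List (Fin τ × V)} {u v : V}
    (h : ¬ G.Secure cs u v) (h' : G.Secure (cs ++ ds) u v) :
    ∃ c ∈ ds, G.Reaches c u ∨ G.Reaches c v := by
  by_contra hn
  push Not at hn
  obtain ⟨⟨a, ha, ha'⟩, ⟨b, hb, hb'⟩, hs⟩ := h'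
  refine h ⟨⟨a, (List.mem_append.1 ha).resolve_right fun h => (hn a h).1 ha', ha'⟩,
    ⟨b, (List.mem_append.1 hb).resolve_right fun h => (hn b h).2 hb', hb'⟩, ?_⟩
  rw [List.map_append, List.sum_append, List.sum_eq_zero (l := ds.map _), add_zero] at hs
  · exact hs
  · intro x hx
    obtain ⟨c, hc, rfl⟩ := List.mem_map.1 hx
    exact weight_eq_zero.2 (not_or.2 (hn c hc))

/-- A cop that is needed at a place can be replaced by one that starts at that place. -/
theorem Secure.replace {cs ds ds' : List (Fin τ × V)} {c : Fin τ × V} {x u v : V}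
    (h : G.Secure (cs ++ ds) u v) (hds : ds.Perm (c :: ds')) (hc : G.Reaches c x) :
    G.Secure (cs ++ [(c.1, x)] ++ ds') u v := by
  have hr : ∀ y, G.Reaches (c.1, x) y ↔ G.Reaches c y := fun y =>
    ⟨fun h => SimpleGraph.Reachable.trans hc h,
      fun h => SimpleGraph.Reachable.trans (SimpleGraph.Reachable.symm hc) h⟩
  have hw : G.weight u v (c.1, x) = G.weight u v c := by
    classical exact if_congr (or_congr (hr u) (hr v)) rfl rfl
  obtain ⟨h1, h2, h3⟩ := h
  rw [((hds.append_left cs).map _).sum_eq] at h3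
  refine ⟨?_, ?_, ?_⟩
  · simpa [(hds.append_left cs).mem_iff, or_and_right, exists_or, hr] using h1
  · simpa [(hds.append_left cs).mem_iff, or_and_right, exists_or, hr] using h2
  · simpa [hw, add_assoc] using h3

/-- The cop that is selected at the edge `uv` by the digit `d`. -/
def nextCop (hτ : 0 < τ) (e : V × V) (d : ℕ) : Fin τ × V :=
  (⟨d % τ, Nat.mod_lt _ hτ⟩, if d < τ then e.1 else e.2)

/-- Add a cop at the edge `pick cs`, as told by the last digit of a code in base `2 * τ`. -/
def searchStep (hτ : 0 < τ) (pick : List (Fin τ × V) → V × V)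
    (x : List (Fin τ × V) × ℕ) : List (Fin τ × V) × ℕ :=
  (x.1 ++ [nextCop hτ (pick x.1) (x.2 % (2 * τ))], x.2 / (2 * τ))

theorem length_searchStep_iterate (hτ : 0 < τ) (pick : List (Fin τ × V) → V × V) (m : ℕ)
    (x : List (Fin τ × V) × ℕ) : ((searchStep hτ pick)^[m] x).1.length = x.1.length + m := by
  induction m with
  | zero => rfl
  | succ m ih =>
    rw [Function.iterate_succ_apply', searchStep, List.length_append, ih]
    rfl

theorem Solves.searchStep_iterate {hτ : 0 < τ} {pick : List (Fin τ × V) → V × V}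
    {x : List (Fin τ × V) × ℕ} (h : G.Solves x.1) (m : ℕ) :
    G.Solves ((searchStep hτ pick)^[m] x).1 := by
  induction m generalizing x with
  | zero => exact h
  | succ m ih =>
    rw [Function.iterate_succ_apply]
    exact ih fun u v huv => (h u v huv).append _

/-- Induction on the cops `ds` still missing from a solution: at the picked edge one of them is
needed, it is moved to the end that it reaches, and its layer and this end form the next digit. If
`cs` already solves the instance, any remaining digits do. -/
theorem exists_code {hτ : 0 < τ} {pick : List (Fin τ × V) → V × V}
    (hpick : ∀ cs, ¬ G.Solves cs →
      G.robberLayer.Adj (pick cs).1 (pick cs).2 ∧ ¬ G.Secure cs (pick cs).1 (pick cs).2)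
    (m : ℕ) (cs ds : List (Fin τ × V)) (hds : ds.length = m) (h : G.Solves (cs ++ ds)) :
    ∃ code < (2 * τ) ^ m, G.Solves ((searchStep hτ pick)^[m] (cs, code)).1 := by
  classical
  induction m generalizing cs ds with
  | zero =>
    obtain rfl := List.length_eq_zero_iff.1 hds
    exact ⟨0, by simp, by simpa using h⟩
  | succ m ih =>
    by_cases hcs : G.Solves cs
    · exact ⟨0, by positivity, Solves.searchStep_iterate hcs _⟩
    obtain ⟨hadj, hbad⟩ := hpick cs hcs
    obtain ⟨c, hc, hr⟩ := exists_reaches_of_secure_append hbad (h _ _ hadj)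
    have hperm := List.perm_cons_erase hc
    obtain ⟨d, hd, x, hx, hnext⟩ : ∃ d < 2 * τ, ∃ x, G.Reaches c x ∧
        nextCop hτ (pick cs) d = (c.1, x) := by
      -- The digits below `τ` stand for a layer at the first end, the others for a layer at the
      -- second end.
      rcases hr with hr | hr
      · exact ⟨c.1, by omega, _, hr, by
          simp [nextCop, Nat.mod_eq_of_lt c.1.2]⟩
      · exact ⟨c.1 + τ, by omega, _, hr, by
          simp [nextCop, Nat.mod_eq_of_lt c.1.2]⟩
    obtain ⟨code, hcode, hsol⟩ := ih (cs ++ [(c.1, x)]) (ds.erase c)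
      (by rw [List.length_erase_of_mem hc, hds]; rfl)
      (fun u v huv => (h u v huv).replace hperm hx)
    refine ⟨d + 2 * τ * code, ?_, ?_⟩
    · calc d + 2 * τ * code < 2 * τ * (code + 1) := by rw [Nat.mul_succ]; omega
        _ ≤ 2 * τ * (2 * τ) ^ m := Nat.mul_le_mul_left _ hcode
        _ = (2 * τ) ^ (m + 1) := (pow_succ' _ _).symm
    · have h0 : 0 < 2 * τ := by omega
      have h1 : (d + 2 * τ * code) % (2 * τ) = d := by
        rw [Nat.add_mul_mod_self_left, Nat.mod_eq_of_lt hd]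
      have h2 : (d + 2 * τ * code) / (2 * τ) = code := by
        rw [Nat.add_mul_div_left _ _ h0, Nat.div_eq_of_lt hd, zero_add]
      rw [Function.iterate_succ_apply, searchStep, h1, h2, hnext]
      exact hsol

theorem multiLayerCopsAndRobber_iff_code [Finite V] (hR : G.robberLayer.IsTree) {k : ℕ}
    (hk : 1 ≤ k) {hτ : 0 < τ} {pick : List (Fin τ × V) → V × V}
    (hpick : ∀ cs, ¬ G.Solves cs →
      G.robberLayer.Adj (pick cs).1 (pick cs).2 ∧ ¬ G.Secure cs (pick cs).1 (pick cs).2) :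
    G.MultiLayerCopsAndRobber k ↔
      ∃ code < (2 * τ) ^ k, G.Solves ((searchStep hτ pick)^[k] ([], code)).1 := by
  rw [multiLayerCopsAndRobber_iff hR hk]
  constructor
  · rintro ⟨cs, hlen, hcs⟩
    exact exists_code hpick k [] cs hlen hcs
  · rintro ⟨code, -, h⟩
    exact ⟨_, by rw [length_searchStep_iterate]; simp, h⟩

end MultiLayerGraph

/-! ## Reachability in the cop layers -/

namespace RAM

open MultiLayerGraph

/-- The product of an expression in which variable `20` does not occur with parameter `0`. -/
def Exp.scale (e : Exp) : Exp := .sum 20 0 e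

/-- The entry for `u` and `v` of matrix number `i` in array `a`. -/
def Exp.cell (a : ℕ) (i u v : Exp) : Exp := .load a (.add (.scale (.add (.scale i) u)) v)

theorem Exp.eval_scale {ρ : ℕ → ℕ} {σ : Store} {e : Exp}
    (h : ∀ j, e.eval ρ (σ.setVar 20 j) = e.eval ρ σ) : e.scale.eval ρ σ = ρ 0 * e.eval ρ σ := by
  simp [scale, eval, h]

/-- The position of the entry for `u` and `v` of the `i`-th matrix of size `n`. -/
def cellIndex (n i u v : ℕ) : ℕ := n * (n * i + u) + v

theorem mul_add_inj {n a a' b b' : ℕ} (hb : b < n) (hb' : b' < n)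
    (h : n * a + b = n * a' + b') : a = a' ∧ b = b' := by
  have hn : 0 < n := by omega
  have h1 := congrArg (· / n) h
  have h2 := congrArg (· % n) h
  simp only [Nat.mul_add_div hn, Nat.mul_add_mod, Nat.div_eq_of_lt hb, Nat.div_eq_of_lt hb',
    Nat.mod_eq_of_lt hb, Nat.mod_eq_of_lt hb', add_zero] at h1 h2
  exact ⟨h1, h2⟩

theorem cellIndex_inj {n i u v i' u' v' : ℕ} (hu : u < n) (hv : v < n) (hu' : u' < n)
    (hv' : v' < n) (h : cellIndex n i u v = cellIndex n i' u' v') : i = i' ∧ u = u' ∧ v = v' := by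
  obtain ⟨h1, h2⟩ := mul_add_inj hv hv' h
  obtain ⟨h3, h4⟩ := mul_add_inj hu hu' h1
  exact ⟨h3, h4, h2⟩

theorem Exp.eval_cell {ρ : ℕ → ℕ} {σ : Store} {a : ℕ} {i u v : Exp}
    (hi : ∀ x j, i.eval ρ ((σ.setVar 20 x).setVar 20 j) = i.eval ρ σ)
    (hu : ∀ j, u.eval ρ (σ.setVar 20 j) = u.eval ρ σ) :
    (Exp.cell a i u v).eval ρ σ =
      σ.arr a (cellIndex (ρ 0) (i.eval ρ σ) (u.eval ρ σ) (v.eval ρ σ)) := by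
  have hi' : ∀ j, i.eval ρ (σ.setVar 20 j) = i.eval ρ σ := fun j => by
    have := hi 0 j
    simpa [Store.setVar] using this
  have h1 : i.scale.eval ρ σ = ρ 0 * i.eval ρ σ := eval_scale hi'
  have h2 : ∀ x, i.scale.eval ρ (σ.setVar 20 x) = ρ 0 * i.eval ρ σ := fun x => by
    rw [eval_scale fun j => by rw [hi, hi'], hi']
  have h3 : (Exp.add i.scale u).scale.eval ρ σ = ρ 0 * (ρ 0 * i.eval ρ σ + u.eval ρ σ) := by
    rw [eval_scale fun j => by simp [eval, h1, h2, hu]]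
    simp [eval, h1]
  simp [cell, eval, h3, cellIndex]

/-- A vertex is joined to itself, to what it was joined to before, and to the neighbours of what it
was joined to before. -/
def reachExp : Exp :=
  .ite (.add (.cell 2 (.var 2) (.var 3) (.var 4))
    (.add (.ite (.add (.sub (.var 3) (.var 4)) (.sub (.var 4) (.var 3))) (.const 0) (.const 1))
      (.sum 5 0 (.ite (.cell 2 (.var 2) (.var 3) (.var 5)) (.cell 0 (.var 2) (.var 5) (.var 4))
        (.const 0))))) (.const 1) (.const 0)

theorem eval_reachExp (ρ : ℕ → ℕ) (σ : Store) : reachExp.eval ρ σ ≠ 0 ↔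
    σ.arr 2 (cellIndex (ρ 0) (σ.var 2) (σ.var 3) (σ.var 4)) ≠ 0 ∨ σ.var 3 = σ.var 4 ∨
      ∃ m < ρ 0, σ.arr 2 (cellIndex (ρ 0) (σ.var 2) (σ.var 3) m) ≠ 0 ∧
        σ.arr 0 (cellIndex (ρ 0) (σ.var 2) m (σ.var 4)) ≠ 0 := by
  have h1 : (Exp.cell 2 (.var 2) (.var 3) (.var 4)).eval ρ σ =
      σ.arr 2 (cellIndex (ρ 0) (σ.var 2) (σ.var 3) (σ.var 4)) :=
    Exp.eval_cell (by simp [Exp.eval]) (by simp [Exp.eval])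
  have h2 : ∀ m, (Exp.cell 2 (.var 2) (.var 3) (.var 5)).eval ρ (σ.setVar 5 m) =
      σ.arr 2 (cellIndex (ρ 0) (σ.var 2) (σ.var 3) m) := fun m => by
    rw [Exp.eval_cell (by simp [Exp.eval]) (by simp [Exp.eval])]
    simp [Exp.eval]
  have h3 : ∀ m, (Exp.cell 0 (.var 2) (.var 5) (.var 4)).eval ρ (σ.setVar 5 m) =
      σ.arr 0 (cellIndex (ρ 0) (σ.var 2) m (σ.var 4)) := fun m => by
    rw [Exp.eval_cell (by simp [Exp.eval]) (by simp [Exp.eval])]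
    simp [Exp.eval]
  have h4 : (σ.var 3 - σ.var 4 = 0 ∧ σ.var 4 - σ.var 3 = 0) ↔ σ.var 3 = σ.var 4 := by omega
  simp only [reachExp, Exp.eval, h1, h2, h3]
  rw [ite_ne_right_iff, ← not_iff_not]
  simp only [ne_eq, one_ne_zero, not_false_eq_true, and_true, not_not, Nat.add_eq_zero_iff,
    Finset.sum_eq_zero_iff, Finset.mem_range, h4, not_or, not_exists, not_and,
    Classical.not_imp]
  refine and_congr_right fun _ => and_congr (by simp) (forall_congr' fun m =>
    forall_congr' fun _ => by simp)

variable {n τ : ℕ}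

/-- The array `a` holds the adjacency matrices of the cop layers. -/
def CopLayers (G : MultiLayerGraph (Fin n) τ) (a : ℕ → ℕ) : Prop :=
  ∀ (i : Fin τ) (u v : Fin n), a (cellIndex n i u v) ≠ 0 ↔ (G.copLayer i).Adj u v

/-- The array `a` only joins vertices that are connected in the cop layers. -/
def Sound (G : MultiLayerGraph (Fin n) τ) (a : ℕ → ℕ) : Prop :=
  ∀ (i : Fin τ) (u v : Fin n), a (cellIndex n i u v) ≠ 0 → (G.copLayer i).Reachable u v

/-- The array `a` joins `u` and `v` if they are joined by a walk of length less than `r`. -/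
def Complete (G : MultiLayerGraph (Fin n) τ) (a : ℕ → ℕ) (r : ℕ) (i : Fin τ) (u v : Fin n) :
    Prop :=
  ∀ w : (G.copLayer i).Walk u v, w.length < r → a (cellIndex n i u v) ≠ 0

/-- Only array `2` changes; it keeps its entries, and it remains sound. -/
structure Extends (G : MultiLayerGraph (Fin n) τ) (σ σ' : Store) : Prop where
  arr : ∀ a, a ≠ 2 → σ'.arr a = σ.arr a
  keep : ∀ j, σ.arr 2 j ≠ 0 → σ'.arr 2 j ≠ 0
  sound : Sound G (σ.arr 2) → Sound G (σ'.arr 2)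

namespace Extends

variable {G : MultiLayerGraph (Fin n) τ} {σ σ' σ'' : Store}

theorem refl (G : MultiLayerGraph (Fin n) τ) (σ : Store) : Extends G σ σ :=
  ⟨fun _ _ => rfl, fun _ => id, id⟩

theorem trans (h : Extends G σ σ') (h' : Extends G σ' σ'') : Extends G σ σ'' :=
  ⟨fun a ha => (h'.arr a ha).trans (h.arr a ha), fun j hj => h'.keep j (h.keep j hj),
    fun hs => h'.sound (h.sound hs)⟩

theorem complete (h : Extends G σ σ') {r : ℕ} {i : Fin τ} {u v : Fin n}
    (hc : Complete G (σ.arr 2) r i u v) : Complete G (σ'.arr 2) r i u v :=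
  fun w hw => h.keep _ (hc w hw)

end Extends

/-- Update one entry of the reachability matrices. -/
def reachCell : Cmd :=
  .store 2 (.add (.scale (.add (.scale (.var 2)) (.var 3))) (.var 4)) reachExp

/-- The matrices are updated in place, so an entry may be ahead of its round. This is harmless:
`Complete` only bounds the entries from below and `Sound` from above. -/
theorem run_reachCell {G : MultiLayerGraph (Fin n) τ} {ρ : ℕ → ℕ} (hn : ρ 0 = n) {σ : Store}
    (hA : CopLayers G (σ.arr 0)) {i : Fin τ} {u v : Fin n} (hi : σ.var 2 = i) (hu : σ.var 3 = u)
    (hv : σ.var 4 = v) {r : ℕ} (hr : ∀ i u v, Complete G (σ.arr 2) r i u v) :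
    Extends G σ (reachCell.run ρ σ) ∧ Complete G ((reachCell.run ρ σ).arr 2) (r + 1) i u v := by
  have hrun : reachCell.run ρ σ = σ.setArr 2 (cellIndex n i u v) (reachExp.eval ρ σ) := by
    have h1 : (Exp.add (.scale (.add (.scale (.var 2)) (.var 3))) (.var 4)).eval ρ σ =
        cellIndex n i u v := by
      -- In a store whose arrays are the identity, loading a cell returns its address, so the
      -- formula for cells also evaluates the address.
      have h := Exp.eval_cell (ρ := ρ) (σ := { σ with arr := fun _ j => j }) (a := 0)
        (i := .var 2) (u := .var 3) (v := .var 4) (by simp [Exp.eval]) (by simp [Exp.eval])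
      simpa [Exp.cell, Exp.scale, Exp.eval, hn, hi, hu, hv] using h
    rw [reachCell, Cmd.run, h1]
  have he := eval_reachExp ρ σ
  rw [hn, hi, hu, hv] at he
  rw [hrun]
  refine ⟨⟨fun a ha => ?_, fun j hj => ?_, fun hs i' u' v' h => ?_⟩, fun w hw => ?_⟩
  · funext j
    simp [Store.setArr_arr, ha]
  · rw [Store.setArr_arr]
    split_ifs with h
    · exact he.2 (Or.inl (h.2 ▸ hj))
    · exact hj
  · rw [Store.setArr_arr] at h
    split_ifs at h with h'
    · obtain ⟨h1, h2, h3⟩ := cellIndex_inj u'.2 v'.2 u.2 v.2 h'.2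
      obtain rfl := Fin.ext h1
      obtain rfl := Fin.ext h2
      obtain rfl := Fin.ext h3
      rcases he.1 h with h | h | ⟨m, hm, h, h'⟩
      · exact hs _ _ _ h
      · exact Fin.ext h ▸ SimpleGraph.Reachable.refl _
      · exact (hs i' u' ⟨m, hm⟩ h).trans ((hA i' ⟨m, hm⟩ v').1 h').reachable
    · exact hs _ _ _ h
  · rw [Store.setArr_arr, if_pos ⟨rfl, rfl⟩]
    refine he.2 (Or.inr ?_)
    -- Reversing the walk exposes its last edge, which is the one the update appends.
    have hw' : w.reverse.length < r + 1 := by simpa using hw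
    generalize w.reverse = w' at hw'
    cases w' with
    | nil => exact Or.inl rfl
    | @cons _ m _ h p =>
      rw [SimpleGraph.Walk.length_cons] at hw'
      exact Or.inr ⟨m, m.2, hr i u m p.reverse (by simpa using hw'),
        (hA i m v).2 h.symm⟩

/-- Compute the connected components of all cop layers. -/
def reachCmd : Cmd := .loop 1 0 (.loop 2 1 (.loop 3 0 (.loop 4 0 reachCell)))

theorem run_reachRow {G : MultiLayerGraph (Fin n) τ} {ρ : ℕ → ℕ} (hn : ρ 0 = n) {σ : Store}
    (hA : CopLayers G (σ.arr 0)) {i : Fin τ} {u : Fin n} (hi : σ.var 2 = i) (hu : σ.var 3 = u)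
    {r : ℕ} (hr : ∀ i u v, Complete G (σ.arr 2) r i u v) :
    (Extends G σ ((Cmd.loop 4 0 reachCell).run ρ σ) ∧
      ((Cmd.loop 4 0 reachCell).run ρ σ).var 2 = i) ∧
    ∀ v, Complete G (((Cmd.loop 4 0 reachCell).run ρ σ).arr 2) (r + 1) i u v := by
  obtain ⟨⟨h1, h2, -⟩, h3⟩ := Cmd.run_loop_of_rel (ρ := ρ) (x := 4) (p := 0) (c := reachCell)
    (R := fun σ σ' => Extends G σ σ' ∧ σ'.var 2 = σ.var 2 ∧ σ'.var 3 = σ.var 3)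
    (fun σ => ⟨.refl G σ, rfl, rfl⟩)
    (fun h h' => ⟨h.1.trans h'.1, h'.2.1.trans h.2.1, h'.2.2.trans h.2.2⟩)
    (Q := fun j σ => ∀ hj : j < n, Complete G (σ.arr 2) (r + 1) i u ⟨j, hj⟩)
    (fun hq hR hj => hR.1.complete (hq hj)) (σ := σ)
    (by
      rintro j hj σ' ⟨hE, hi', hu'⟩
      obtain ⟨g1, g2⟩ := run_reachCell hn (σ := σ'.setVar 4 j) (i := i) (u := u)
        (v := ⟨j, hn ▸ hj⟩) (r := r) (by simpa [hE.arr] using hA) (by simp [hi', hi])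
        (by simp [hu', hu]) (by simp) (fun i u v => hE.complete (hr i u v))
      exact ⟨⟨⟨g1.arr, g1.keep, g1.sound⟩, by simp [reachCell, Cmd.run],
        by simp [reachCell, Cmd.run]⟩, fun _ => g2⟩)
  exact ⟨⟨h1, h2.trans hi⟩, fun v => h3 v (hn.symm ▸ v.2) v.2⟩

theorem run_reachMatrix {G : MultiLayerGraph (Fin n) τ} {ρ : ℕ → ℕ} (hn : ρ 0 = n) {σ : Store}
    (hA : CopLayers G (σ.arr 0)) {i : Fin τ} (hi : σ.var 2 = i)
    {r : ℕ} (hr : ∀ i u v, Complete G (σ.arr 2) r i u v) :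
    Extends G σ ((Cmd.loop 3 0 (.loop 4 0 reachCell)).run ρ σ) ∧
    ∀ u v, Complete G (((Cmd.loop 3 0 (.loop 4 0 reachCell)).run ρ σ).arr 2) (r + 1) i u v := by
  obtain ⟨⟨h1, -⟩, h3⟩ := Cmd.run_loop_of_rel (ρ := ρ) (x := 3) (p := 0)
    (c := .loop 4 0 reachCell)
    (R := fun σ σ' => Extends G σ σ' ∧ σ'.var 2 = σ.var 2)
    (fun σ => ⟨.refl G σ, rfl⟩) (fun h h' => ⟨h.1.trans h'.1, h'.2.trans h.2⟩)
    (Q := fun j σ => ∀ hj : j < n, ∀ v, Complete G (σ.arr 2) (r + 1) i ⟨j, hj⟩ v)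
    (fun hq hR hj v => hR.1.complete (hq hj v)) (σ := σ)
    (by
      rintro j hj σ' ⟨hE, hi'⟩
      obtain ⟨⟨g1, g2⟩, g3⟩ := run_reachRow hn (σ := σ'.setVar 3 j) (i := i)
        (u := ⟨j, hn ▸ hj⟩) (r := r) (by simpa [hE.arr] using hA) (by simp [hi', hi])
        (by simp) (fun i u v => hE.complete (hr i u v))
      exact ⟨⟨⟨g1.arr, g1.keep, g1.sound⟩, g2.trans (hi'.trans hi).symm⟩, fun _ => g3⟩)
  exact ⟨h1, fun u => h3 u (hn.symm ▸ u.2) u.2⟩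

theorem run_reachRound {G : MultiLayerGraph (Fin n) τ} {ρ : ℕ → ℕ} (hn : ρ 0 = n) (hτ : ρ 1 = τ)
    {σ : Store} (hA : CopLayers G (σ.arr 0)) {r : ℕ}
    (hr : ∀ i u v, Complete G (σ.arr 2) r i u v) :
    Extends G σ ((Cmd.loop 2 1 (.loop 3 0 (.loop 4 0 reachCell))).run ρ σ) ∧
    ∀ i u v, Complete G
      (((Cmd.loop 2 1 (.loop 3 0 (.loop 4 0 reachCell))).run ρ σ).arr 2) (r + 1) i u v := by
  obtain ⟨h1, h3⟩ := Cmd.run_loop_of_rel (ρ := ρ) (x := 2) (p := 1)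
    (c := .loop 3 0 (.loop 4 0 reachCell)) (R := Extends G) (.refl G) .trans
    (Q := fun j σ => ∀ hj : j < τ, ∀ u v, Complete G (σ.arr 2) (r + 1) ⟨j, hj⟩ u v)
    (fun hq hR hj u v => hR.complete (hq hj u v)) (σ := σ)
    (by
      intro j hj σ' hE
      obtain ⟨g1, g3⟩ := run_reachMatrix hn (σ := σ'.setVar 2 j) (i := ⟨j, hτ ▸ hj⟩)
        (r := r) (by simpa [hE.arr] using hA) (by simp) (fun i u v => hE.complete (hr i u v))
      exact ⟨⟨g1.arr, g1.keep, g1.sound⟩, fun _ => g3⟩)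
  exact ⟨h1, fun i => h3 i (hτ.symm ▸ i.2) i.2⟩

/-- After `n` rounds all walks of length less than `n` are accounted for, and every path is that
short. -/
theorem run_reachCmd {G : MultiLayerGraph (Fin n) τ} {ρ : ℕ → ℕ} (hn : ρ 0 = n) (hτ : ρ 1 = τ)
    {σ : Store} (hA : CopLayers G (σ.arr 0)) (h2 : σ.arr 2 = 0) :
    (∀ a, a ≠ 2 → (reachCmd.run ρ σ).arr a = σ.arr a) ∧
    ∀ (i : Fin τ) (u v : Fin n), (reachCmd.run ρ σ).arr 2 (cellIndex n i u v) ≠ 0 ↔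
      (G.copLayer i).Reachable u v := by
  obtain ⟨hE, hC⟩ := Cmd.run_loop_of_inv (ρ := ρ) (x := 1) (p := 0)
    (c := .loop 2 1 (.loop 3 0 (.loop 4 0 reachCell)))
    (I := fun r σ' => Extends G σ σ' ∧ ∀ i u v, Complete G (σ'.arr 2) r i u v)
    (σ := σ) ⟨.refl G σ, fun _ _ _ _ h => absurd h (Nat.not_lt_zero _)⟩
    (by
      rintro r - σ' ⟨hE, hC⟩
      obtain ⟨g1, g2⟩ := run_reachRound hn hτ (G := G) (σ := σ'.setVar 1 r) (r := r)
        (by simpa [hE.arr] using hA) hC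
      exact ⟨hE.trans ⟨g1.arr, g1.keep, g1.sound⟩, g2⟩)
  refine ⟨hE.arr, fun i u v => ⟨hE.sound (fun _ _ _ h => absurd (by simp [h2]) h) i u v, ?_⟩⟩
  intro h
  obtain ⟨w, hw⟩ := h.exists_isPath
  exact hC i u v w (by simpa [hn] using hw.length_lt)

end RAM

/-! ## The search program -/

namespace RAM

open MultiLayerGraph

variable {n τ : ℕ}

/-- The arrays hold the layers of `G` and the connected components of its cop layers. -/
structure Prepared (G : MultiLayerGraph (Fin n) τ) (σ : Store) : Prop where
  cop : CopLayers G (σ.arr 0)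
  robber : ∀ u v : Fin n, σ.arr 1 (n * u + v) ≠ 0 ↔ G.robberLayer.Adj u v
  reach : ∀ (i : Fin τ) (u v : Fin n),
    σ.arr 2 (cellIndex n i u v) ≠ 0 ↔ (G.copLayer i).Reachable u v

theorem Prepared.congr {G : MultiLayerGraph (Fin n) τ} {σ σ' : Store} (h : Prepared G σ)
    (hσ : ∀ a < 3, σ'.arr a = σ.arr a) : Prepared G σ' :=
  ⟨by rw [hσ 0 (by omega)]; exact h.cop, by rw [hσ 1 (by omega)]; exact h.robber,
    by rw [hσ 2 (by omega)]; exact h.reach⟩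

/-- Arrays `3` and `4` hold the layers and the vertices of the cops in `cs`. -/
def Holds (cs : List (Fin τ × Fin n)) (σ : Store) : Prop :=
  ∀ l (h : l < cs.length), σ.arr 3 l = (cs[l]).1 ∧ σ.arr 4 l = (cs[l]).2

theorem Holds.congr {cs : List (Fin τ × Fin n)} {σ σ' : Store} (h : Holds cs σ)
    (h3 : σ'.arr 3 = σ.arr 3) (h4 : σ'.arr 4 = σ.arr 4) : Holds cs σ' := by
  intro l hl
  rw [h3, h4]
  exact h l hl

/-- The sum of `e` over the cops that have been placed so far; `6` is the cop. -/
def Exp.overCops (e : Exp) : Exp := .sum 6 2 (.ite (.sub (.var 7) (.var 6)) e (.const 0))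

/-- Sums are bounded by parameters only, so the sum runs up to `ρ 2`, and a test against variable
`7` cuts off the cops not yet placed. -/
theorem Exp.eval_overCops {ρ : ℕ → ℕ} {σ : Store} {e : Exp} {α : Type*} (cs : List α)
    (hk : cs.length ≤ ρ 2) (h7 : σ.var 7 = cs.length) (f : α → ℕ)
    (hf : ∀ l (h : l < cs.length), e.eval ρ (σ.setVar 6 l) = f cs[l]) :
    (overCops e).eval ρ σ = (cs.map f).sum := by
  have h1 : (overCops e).eval ρ σ =
      ∑ l ∈ Finset.range (ρ 2), if l < cs.length then e.eval ρ (σ.setVar 6 l) else 0 := by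
    simp [overCops, eval, h7, Nat.sub_eq_zero_iff_le]
  have h2 : (cs.map f).sum = ∑ i : Fin cs.length, f cs[i] := by
    rw [← List.sum_ofFn]
    congr 1
    conv_lhs => rw [← List.ofFn_get cs, List.map_ofFn]
    rfl
  have h3 : ∑ l ∈ Finset.range cs.length,
      (if l < cs.length then e.eval ρ (σ.setVar 6 l) else 0) = ∑ i : Fin cs.length, f cs[i] := by
    rw [Finset.sum_range]
    exact Finset.sum_congr rfl fun i _ => by rw [if_pos i.2, hf i i.2]; rfl
  rw [h1, h2, ← h3]
  refine (Finset.sum_subset (Finset.range_mono hk) fun l _ hl => ?_).symm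
  rw [if_neg (by simpa using hl)]

/-- The cop in question can reach `w`. -/
def reachesExp (w : Exp) : Exp := .cell 2 (.load 3 (.var 6)) (.load 4 (.var 6)) w

/-- The distance between the vertices `3` and `4` in the layer of the cop in question is at most
`2`. -/
def nearExp : Exp :=
  .add (.cell 0 (.load 3 (.var 6)) (.var 3) (.var 4))
    (.sum 5 0 (.ite (.cell 0 (.load 3 (.var 6)) (.var 3) (.var 5))
      (.cell 0 (.load 3 (.var 6)) (.var 5) (.var 4)) (.const 0)))

/-- The sum of the weights of all cops for the edge between the vertices `3` and `4`. -/
def weightExp : Exp :=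
  .overCops (.ite (.add (reachesExp (.var 3)) (reachesExp (.var 4)))
    (.ite nearExp (.const 2) (.const 1)) (.const 0))

/-- The vertices `3` and `4` form an edge of the robber layer that is not secure. -/
def badExp : Exp :=
  .ite (.load 1 (.add (.scale (.var 3)) (.var 4)))
    (.ite (.overCops (reachesExp (.var 3)))
      (.ite (.overCops (reachesExp (.var 4))) (.sub (.const 2) weightExp) (.const 1))
      (.const 1))
    (.const 0)

section Eval

variable {G : MultiLayerGraph (Fin n) τ} {ρ : ℕ → ℕ} {σ : Store} {cs : List (Fin τ × Fin n)}

theorem eval_reachesExp (hn : ρ 0 = n) (hG : Prepared G σ) (hcs : Holds cs σ) {x : ℕ}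
    (hx : x ≠ 6) {w : Fin n} (hw : σ.var x = w) {l : ℕ} (hl : l < cs.length) :
    (reachesExp (.var x)).eval ρ (σ.setVar 6 l) ≠ 0 ↔ G.Reaches cs[l] w := by
  obtain ⟨h3, h4⟩ := hcs l hl
  rw [reachesExp, Exp.eval_cell (by simp [Exp.eval]) (by simp [Exp.eval])]
  simp only [Exp.eval, Store.setVar_arr, Store.setVar_var, if_true, h3, h4, hn, if_neg hx, hw]
  exact hG.reach _ _ _

/-- Adjacency and common neighbours suffice, since `huv` excludes distance 0. -/
theorem eval_nearExp (hn : ρ 0 = n) (hG : Prepared G σ) (hcs : Holds cs σ) {u v : Fin n}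
    (huv : u ≠ v) (hu : σ.var 3 = u) (hv : σ.var 4 = v) {l : ℕ} (hl : l < cs.length) :
    nearExp.eval ρ (σ.setVar 6 l) ≠ 0 ↔ (G.copLayer (cs[l]).1).edist u v < 3 := by
  obtain ⟨h3, h4⟩ := hcs l hl
  have h1 : (Exp.cell 0 (.load 3 (.var 6)) (.var 3) (.var 4)).eval ρ (σ.setVar 6 l) =
      σ.arr 0 (cellIndex n (cs[l]).1 u v) := by
    rw [Exp.eval_cell (by simp [Exp.eval]) (by simp [Exp.eval])]
    simp [Exp.eval, h3, hn, hu, hv]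
  have h2 : ∀ m, (Exp.cell 0 (.load 3 (.var 6)) (.var 3) (.var 5)).eval ρ
      ((σ.setVar 6 l).setVar 5 m) = σ.arr 0 (cellIndex n (cs[l]).1 u m) := fun m => by
    rw [Exp.eval_cell (by simp [Exp.eval]) (by simp [Exp.eval])]
    simp [Exp.eval, h3, hn, hu]
  have h5 : ∀ m, (Exp.cell 0 (.load 3 (.var 6)) (.var 5) (.var 4)).eval ρ
      ((σ.setVar 6 l).setVar 5 m) = σ.arr 0 (cellIndex n (cs[l]).1 m v) := fun m => by
    rw [Exp.eval_cell (by simp [Exp.eval]) (by simp [Exp.eval])]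
    simp [Exp.eval, h3, hn, hv]
  simp only [nearExp, Exp.eval, h1, h2, h5, hn]
  rw [SimpleGraph.edist_lt_three_iff, ← not_iff_not, not_not, Nat.add_eq_zero_iff,
    Finset.sum_eq_zero_iff]
  have hA := hG.cop (cs[l]).1
  constructor
  · rintro ⟨g1, g2⟩ ⟨m, rfl | hm, rfl | hm'⟩
    · exact huv rfl
    · exact (hA _ _).2 hm' g1
    · exact (hA _ _).2 hm g1
    · have := g2 m (Finset.mem_range.2 m.2)
      rw [if_pos ((hA _ _).2 hm)] at this
      exact (hA _ _).2 hm' this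
  · intro h
    refine ⟨?_, fun m hm => ?_⟩
    · by_contra h0
      exact h ⟨v, Or.inr ((hA _ _).1 h0), Or.inl rfl⟩
    · by_contra h0
      rw [ite_eq_right_iff, Classical.not_imp] at h0
      have hm := Finset.mem_range.1 hm
      exact h ⟨⟨m, hm⟩, Or.inr ((hA u ⟨m, hm⟩).1 h0.1), Or.inr ((hA ⟨m, hm⟩ v).1 h0.2)⟩

theorem eval_badExp (hn : ρ 0 = n) (hG : Prepared G σ) (hcs : Holds cs σ)
    (hk : cs.length ≤ ρ 2) (h7 : σ.var 7 = cs.length) {u v : Fin n}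
    (hu : σ.var 3 = u) (hv : σ.var 4 = v) :
    badExp.eval ρ σ ≠ 0 ↔ G.robberLayer.Adj u v ∧ ¬ G.Secure cs u v := by
  have h1 : (Exp.load 1 (.add (.scale (.var 3)) (.var 4))).eval ρ σ = σ.arr 1 (n * u + v) := by
    simp [Exp.eval, Exp.eval_scale, hn, hu, hv]
  have cov : ∀ (x : ℕ) (w : Fin n), x ≠ 6 → σ.var x = w →
      ((Exp.overCops (reachesExp (.var x))).eval ρ σ ≠ 0 ↔ ∃ c ∈ cs, G.Reaches c w) := by
    classical
    intro x w hx hw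
    have hl := fun l hl => eval_reachesExp (ρ := ρ) hn hG hcs hx hw (l := l) hl
    have hs := Exp.eval_overCops (ρ := ρ) (σ := σ) (e := .ite (reachesExp (.var x)) (.const 1)
      (.const 0)) cs hk h7 (fun c => if G.Reaches c w then 1 else 0) (fun l h => by
        simp only [Exp.eval, hl l h])
    -- Only the vanishing of matrix entries is specified, so the sum is compared with one of
    -- indicators.
    have hz : (Exp.overCops (reachesExp (.var x))).eval ρ σ ≠ 0 ↔
        (Exp.overCops (.ite (reachesExp (.var x)) (.const 1) (.const 0))).eval ρ σ ≠ 0 := by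
      simp [Exp.overCops, Exp.eval]
    rw [hz, hs]
    simp [List.sum_eq_zero_iff]
  have hR := hG.robber u v
  have hb : badExp.eval ρ σ = if (Exp.load 1 (.add (.scale (.var 3)) (.var 4))).eval ρ σ ≠ 0 then
      if (Exp.overCops (reachesExp (.var 3))).eval ρ σ ≠ 0 then
        if (Exp.overCops (reachesExp (.var 4))).eval ρ σ ≠ 0 then 2 - weightExp.eval ρ σ else 1
      else 1 else 0 := rfl
  rw [hb, h1]
  by_cases hadj : G.robberLayer.Adj u v
  · have hW : weightExp.eval ρ σ = (cs.map (G.weight u v)).sum := by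
      classical
      refine Exp.eval_overCops cs hk h7 _ fun l hl => ?_
      have g1 := eval_reachesExp (ρ := ρ) hn hG hcs (x := 3) (by omega) hu hl
      have g2 := eval_reachesExp (ρ := ρ) hn hG hcs (x := 4) (by omega) hv hl
      have g3 := eval_nearExp (ρ := ρ) hn hG hcs hadj.ne hu hv hl
      simp only [Exp.eval, weight]
      refine if_congr ?_ (if_congr g3 rfl rfl) rfl
      rw [← g1, ← g2]
      omega
    rw [if_pos (hR.2 hadj), hW, Secure, ← cov 3 u (by omega) hu, ← cov 4 v (by omega) hv]
    split_ifs with h3 h4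
    · simp only [hadj, h3, h4, true_and, ne_eq, not_false_eq_true]
      omega
    · simp [hadj, h4]
    · simp [hadj, h3]
  · rw [if_neg (fun h => hadj (hR.1 h))]
    simp [hadj]

end Eval

/-- The vertices `u` and `v` form an edge of the robber layer that `cs` leaves insecure. -/
def Bad (G : MultiLayerGraph (Fin n) τ) (cs : List (Fin τ × Fin n)) (u v : ℕ) : Prop :=
  ∃ (hu : u < n) (hv : v < n),
    G.robberLayer.Adj ⟨u, hu⟩ ⟨v, hv⟩ ∧ ¬ G.Secure cs ⟨u, hu⟩ ⟨v, hv⟩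

open Classical in
/-- The insecure edge that is chosen by the search program. -/
noncomputable def pick (hn : 0 < n) (G : MultiLayerGraph (Fin n) τ)
    (cs : List (Fin τ × Fin n)) : Fin n × Fin n :=
  (⟨Nat.findGreatest (fun u => ∃ v, Bad G cs u v) (n - 1),
      (Nat.findGreatest_le _).trans_lt (by omega)⟩,
    ⟨Nat.findGreatest (Bad G cs (Nat.findGreatest (fun u => ∃ v, Bad G cs u v) (n - 1))) (n - 1),
      (Nat.findGreatest_le _).trans_lt (by omega)⟩)

theorem pick_spec (hn : 0 < n) (G : MultiLayerGraph (Fin n) τ) (cs : List (Fin τ × Fin n))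
    (h : ¬ G.Solves cs) :
    G.robberLayer.Adj (pick hn G cs).1 (pick hn G cs).2 ∧
      ¬ G.Secure cs (pick hn G cs).1 (pick hn G cs).2 := by
  classical
  simp only [Solves, not_forall] at h
  obtain ⟨u, v, hadj, hs⟩ := h
  have h1 : ∃ v, Bad G cs (pick hn G cs).1 v :=
    Nat.findGreatest_spec (P := fun u => ∃ v, Bad G cs u v) (Nat.le_sub_one_of_lt u.2)
      ⟨v, u.2, v.2, hadj, hs⟩
  obtain ⟨w, hw⟩ := h1
  obtain ⟨_, hwn, _⟩ := id hw
  have h2 : Bad G cs (pick hn G cs).1 (pick hn G cs).2 :=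
    Nat.findGreatest_spec (P := Bad G cs (pick hn G cs).1) (Nat.le_sub_one_of_lt hwn) hw
  obtain ⟨_, _, h⟩ := h2
  exact h

/-- The greatest `y` with `P y` equals the number of `x` that lie below some such `y`; counting
needs only sums and tests. Both sides are 0 if there is no such `y`. -/
theorem sum_eq_findGreatest (g : ℕ → ℕ) (P : ℕ → Prop) [DecidablePred P] (hn : 0 < n)
    (hg : ∀ y < n, g y ≠ 0 ↔ P y) :
    (∑ x ∈ Finset.range n, if (∑ y ∈ Finset.range n, if y - x ≠ 0 then g y else 0) ≠ 0
      then 1 else 0) = Nat.findGreatest P (n - 1) := by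
  have key : ∀ x ∈ Finset.range n,
      ((∑ y ∈ Finset.range n, if y - x ≠ 0 then g y else 0) ≠ 0 ↔
        x < Nat.findGreatest P (n - 1)) := by
    intro x _
    rw [Ne, Finset.sum_eq_zero_iff]
    push Not
    constructor
    · rintro ⟨y, hy, h⟩
      have hy := Finset.mem_range.1 hy
      rw [ite_ne_right_iff] at h
      exact lt_of_lt_of_le (by omega)
        (Nat.le_findGreatest (Nat.le_sub_one_of_lt hy) ((hg y hy).1 h.2))
    · intro hx
      have hle := Nat.findGreatest_le (P := P) (n - 1)
      refine ⟨Nat.findGreatest P (n - 1), Finset.mem_range.2 (by omega), ?_⟩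
      rw [ite_ne_right_iff]
      exact ⟨by omega, (hg _ (by omega)).2
        (Nat.findGreatest_of_ne_zero (m := Nat.findGreatest P (n - 1)) rfl (by omega))⟩
  have hle := Nat.findGreatest_le (P := P) (n - 1)
  rw [Finset.sum_boole, Finset.filter_congr key]
  have : (Finset.range n).filter (fun x => x < Nat.findGreatest P (n - 1)) =
      Finset.range (Nat.findGreatest P (n - 1)) := by
    ext x
    simp only [Finset.mem_filter, Finset.mem_range]
    omega
  rw [this]
  simp

/-- The first vertex of the chosen edge. -/
def pickFst : Exp :=
  .sum 8 0 (.ite (.sum 3 0 (.ite (.sub (.var 3) (.var 8)) (.sum 4 0 badExp) (.const 0)))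
    (.const 1) (.const 0))

/-- The second vertex of the chosen edge. -/
def pickSnd : Exp :=
  .sum 8 0 (.ite (.sum 4 0 (.ite (.sub (.var 4) (.var 8)) badExp (.const 0)))
    (.const 1) (.const 0))

section Eval

variable {G : MultiLayerGraph (Fin n) τ} {ρ : ℕ → ℕ} {σ : Store} {cs : List (Fin τ × Fin n)}

theorem eval_badExp_iff (hn : ρ 0 = n) (hG : Prepared G σ) (hcs : Holds cs σ)
    (hk : cs.length ≤ ρ 2) (h7 : σ.var 7 = cs.length) (hu : σ.var 3 < n) (hv : σ.var 4 < n) :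
    badExp.eval ρ σ ≠ 0 ↔ Bad G cs (σ.var 3) (σ.var 4) := by
  rw [eval_badExp hn hG hcs hk h7 (u := ⟨_, hu⟩) (v := ⟨_, hv⟩) rfl rfl]
  exact ⟨fun h => ⟨hu, hv, h⟩, fun ⟨_, _, h⟩ => h⟩

theorem sum_badExp_iff (hn : ρ 0 = n) (hG : Prepared G σ) (hcs : Holds cs σ)
    (hk : cs.length ≤ ρ 2) (h7 : σ.var 7 = cs.length) (hu : σ.var 3 < n) :
    (Exp.sum 4 0 badExp).eval ρ σ ≠ 0 ↔ ∃ v, Bad G cs (σ.var 3) v := by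
  rw [Exp.eval, hn, Ne, Finset.sum_eq_zero_iff]
  push Not
  have key : ∀ v < n, (badExp.eval ρ (σ.setVar 4 v) ≠ 0 ↔ Bad G cs (σ.var 3) v) := fun v hv => by
    have := eval_badExp_iff (σ := σ.setVar 4 v) hn (hG.congr fun _ _ => rfl)
      (hcs.congr rfl rfl) hk (by simpa using h7) (by simpa using hu) (by simpa using hv)
    simpa using this
  constructor
  · rintro ⟨v, hv, h⟩
    exact ⟨v, (key v (Finset.mem_range.1 hv)).1 h⟩
  · rintro ⟨v, h⟩
    obtain ⟨_, hv, _⟩ := id h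
    exact ⟨v, Finset.mem_range.2 hv, (key v hv).2 h⟩

theorem sum_sum_badExp_iff (hn : ρ 0 = n) (hG : Prepared G σ) (hcs : Holds cs σ)
    (hk : cs.length ≤ ρ 2) (h7 : σ.var 7 = cs.length) :
    (Exp.sum 3 0 (.sum 4 0 badExp)).eval ρ σ ≠ 0 ↔ ¬ G.Solves cs := by
  rw [Exp.eval, hn, Ne, Finset.sum_eq_zero_iff]
  simp only [Solves, not_forall]
  have key : ∀ u < n, ((Exp.sum 4 0 badExp).eval ρ (σ.setVar 3 u) ≠ 0 ↔ ∃ v, Bad G cs u v) :=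
    fun u hu => by
      have := sum_badExp_iff (σ := σ.setVar 3 u) hn (hG.congr fun _ _ => rfl)
        (hcs.congr rfl rfl) hk (by simpa using h7) (by simpa using hu)
      simpa using this
  constructor
  · rintro ⟨u, hu, h⟩
    obtain ⟨v, hu, hv, h, h'⟩ := (key u (Finset.mem_range.1 hu)).1 h
    exact ⟨_, _, h, h'⟩
  · rintro ⟨u, v, h, h'⟩
    exact ⟨u, Finset.mem_range.2 u.2, (key u u.2).2 ⟨v, u.2, v.2, h, h'⟩⟩

theorem eval_pickFst (hn : ρ 0 = n) (hpos : 0 < n) (hG : Prepared G σ) (hcs : Holds cs σ)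
    (hk : cs.length ≤ ρ 2) (h7 : σ.var 7 = cs.length) :
    pickFst.eval ρ σ = (pick hpos G cs).1 := by
  classical
  simp only [pickFst, Exp.eval, hn, pick]
  have key : ∀ x, ∀ y < n, ((Exp.sum 4 0 badExp).eval ρ ((σ.setVar 8 x).setVar 3 y) ≠ 0 ↔
      ∃ v, Bad G cs y v) := fun x y hy => by
    have := sum_badExp_iff (σ := (σ.setVar 8 x).setVar 3 y) hn (hG.congr fun _ _ => rfl)
      (hcs.congr rfl rfl) hk (by simpa using h7) (by simpa using hy)
    simpa using this
  rw [← sum_eq_findGreatest (fun y => if ∃ v, Bad G cs y v then 1 else 0) _ hpos (by simp)]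
  refine Finset.sum_congr rfl fun x _ => if_congr (not_congr ?_) rfl rfl
  rw [Finset.sum_eq_zero_iff, Finset.sum_eq_zero_iff]
  refine forall_congr' fun y => forall_congr' fun hy => ?_
  have := key x y (Finset.mem_range.1 hy)
  rw [Exp.eval, hn] at this
  refine ite_eq_right_iff.trans ((imp_congr (by simp) ?_).trans ite_eq_right_iff.symm)
  rw [← not_iff_not]
  exact this.trans (by simp)

theorem eval_pickSnd (hn : ρ 0 = n) (hpos : 0 < n) (hG : Prepared G σ) (hcs : Holds cs σ)
    (hk : cs.length ≤ ρ 2) (h7 : σ.var 7 = cs.length) (h3 : σ.var 3 = (pick hpos G cs).1) :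
    pickSnd.eval ρ σ = (pick hpos G cs).2 := by
  classical
  simp only [pickSnd, Exp.eval, hn]
  have key : ∀ x, ∀ y < n, (badExp.eval ρ ((σ.setVar 8 x).setVar 4 y) ≠ 0 ↔
      Bad G cs (pick hpos G cs).1 y) := fun x y hy => by
    have := eval_badExp_iff (σ := (σ.setVar 8 x).setVar 4 y) hn (hG.congr fun _ _ => rfl)
      (hcs.congr rfl rfl) hk (by simpa using h7) (by simp [h3]) (by simpa using hy)
    simpa [h3] using this
  have hp : ((pick hpos G cs).2 : ℕ) =
    Nat.findGreatest (Bad G cs (pick hpos G cs).1) (n - 1) := rfl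
  rw [hp, ← sum_eq_findGreatest
    (fun y => if Bad G cs (pick hpos G cs).1 y then 1 else 0) _ hpos (by simp)]
  refine Finset.sum_congr rfl fun x _ => if_congr (not_congr ?_) rfl rfl
  rw [Finset.sum_eq_zero_iff, Finset.sum_eq_zero_iff]
  refine forall_congr' fun y => forall_congr' fun hy => ?_
  have := key x y (Finset.mem_range.1 hy)
  refine ite_eq_right_iff.trans ((imp_congr (by simp) ?_).trans ite_eq_right_iff.symm)
  rw [← not_iff_not]
  exact this.trans (by simp)

end Eval

/-- The quotient of variable `10` by `2 * τ`. -/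
def quotExp : Exp :=
  .sum 11 3 (.ite (.sub (.sum 12 1 (.add (.add (.var 11) (.const 1)) (.add (.var 11) (.const 1))))
    (.var 10)) (.const 0) (.const 1))

/-- Division is counting: the quotient of `a` by `2 * τ` is the number of `x` with `2 * τ * (x + 1)
≤ a`, and all of these lie below `ρ 3`. -/
theorem eval_quotExp {ρ : ℕ → ℕ} {σ : Store} (hτ : 0 < ρ 1) (h : σ.var 10 < ρ 3) :
    quotExp.eval ρ σ = σ.var 10 / (2 * ρ 1) := by
  have h1 : quotExp.eval ρ σ =
      ∑ x ∈ Finset.range (ρ 3), if x < σ.var 10 / (2 * ρ 1) then 1 else 0 := by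
    simp only [quotExp, Exp.eval]
    refine Finset.sum_congr rfl fun x _ => ?_
    have h2 : x < σ.var 10 / (2 * ρ 1) ↔ ρ 1 * (x + 1 + (x + 1)) ≤ σ.var 10 := by
      rw [← Nat.succ_le_iff, Nat.le_div_iff_mul_le (by omega)]
      rw [show x.succ * (2 * ρ 1) = ρ 1 * (x + 1 + (x + 1)) by rw [Nat.succ_eq_add_one]; ring]
    simp only [Store.setVar_var, Finset.sum_const, Finset.card_range, smul_eq_mul,
      if_true, if_false, Nat.reduceEqDiff, ne_eq, ite_not]
    exact if_congr (by rw [h2]; omega) rfl rfl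
  have hle : σ.var 10 / (2 * ρ 1) ≤ ρ 3 := (Nat.div_le_self _ _).trans h.le
  have h3 : (Finset.range (ρ 3)).filter (fun x => x < σ.var 10 / (2 * ρ 1)) =
      Finset.range (σ.var 10 / (2 * ρ 1)) := by
    ext x
    simp only [Finset.mem_filter, Finset.mem_range]
    omega
  rw [h1, Finset.sum_boole, h3]
  simp

/-- Place one cop; `10` is the code for the remaining choices, `7` the number of cops so far. -/
def stepCmd : Cmd :=
  .seq (.assign 3 pickFst) <|
  .seq (.assign 4 pickSnd) <|
  .seq (.assign 13 quotExp) <|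
  .seq (.assign 14 (.sub (.var 10) (.sum 12 1 (.add (.var 13) (.var 13))))) <|
  .seq (.store 3 (.var 7) (.ite (.sub (.prm 1) (.var 14)) (.var 14) (.sub (.var 14) (.prm 1)))) <|
  .seq (.store 4 (.var 7) (.ite (.sub (.prm 1) (.var 14)) (.var 3) (.var 4))) <|
  .assign 10 (.var 13)

variable {G : MultiLayerGraph (Fin n) τ} {ρ : ℕ → ℕ}

theorem run_stepCmd (hn : ρ 0 = n) (hpos : 0 < n) (hτ : ρ 1 = τ) (hτ0 : 0 < τ) {σ : Store}
    {x : List (Fin τ × Fin n) × ℕ} (hG : Prepared G σ) (hcs : Holds x.1 σ)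
    (hk : x.1.length ≤ ρ 2) (h7 : σ.var 7 = x.1.length) (h10 : σ.var 10 = x.2)
    (hx : x.2 < ρ 3) :
    Prepared G (stepCmd.run ρ σ) ∧ Holds (searchStep hτ0 (pick hpos G) x).1 (stepCmd.run ρ σ) ∧
      (stepCmd.run ρ σ).var 10 = (searchStep hτ0 (pick hpos G) x).2 ∧
      (stepCmd.run ρ σ).var 15 = σ.var 15 := by
  obtain ⟨cs, c⟩ := x
  dsimp only at hcs hk h7 h10 hx
  have e1 := eval_pickFst hn hpos hG hcs hk h7
  set e := pick hpos G cs with he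
  set σ₁ := σ.setVar 3 e.1 with hσ₁
  have e2 : pickSnd.eval ρ σ₁ = e.2 :=
    eval_pickSnd hn hpos (hG.congr fun _ _ => rfl) (hcs.congr rfl rfl) hk (by simpa [hσ₁] using h7)
      (by simp [hσ₁, he])
  set σ₂ := σ₁.setVar 4 e.2 with hσ₂
  have e3 : quotExp.eval ρ σ₂ = c / (2 * τ) := by
    have h : σ₂.var 10 = c := by simpa [hσ₂, hσ₁] using h10
    rw [eval_quotExp (by omega) (by omega), h, hτ]
  set σ₃ := σ₂.setVar 13 (c / (2 * τ)) with hσ₃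
  have e4 : (Exp.sub (.var 10) (.sum 12 1 (.add (.var 13) (.var 13)))).eval ρ σ₃ =
      c % (2 * τ) := by
    have : c - τ * (c / (2 * τ) + c / (2 * τ)) = c % (2 * τ) := by
      have := Nat.mod_add_div c (2 * τ)
      rw [show 2 * τ * (c / (2 * τ)) = τ * (c / (2 * τ) + c / (2 * τ)) by ring] at this
      omega
    simpa [Exp.eval, hσ₃, hσ₂, hσ₁, h10, hτ] using this
  set d := c % (2 * τ) with hd
  have hdlt : d < 2 * τ := Nat.mod_lt _ (by omega)
  -- As `d < 2 * τ`, one subtraction replaces the remainder.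
  have hlay : (if d < τ then d else d - τ) = d % τ := by
    split_ifs with h
    · rw [Nat.mod_eq_of_lt (by omega)]
    · rw [Nat.mod_eq_sub_mod (by omega), Nat.mod_eq_of_lt (by omega)]
  have hrun : stepCmd.run ρ σ = (((σ₃.setVar 14 d).setArr 3 cs.length (d % τ)).setArr 4 cs.length
      (if d < τ then e.1 else e.2 : Fin n)).setVar 10 (c / (2 * τ)) := by
    simp only [stepCmd, Cmd.run, e1, ← hσ₁, e2, ← hσ₂, e3, ← hσ₃, e4]
    have hlt : τ - d ≠ 0 ↔ d < τ := by omega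
    simp only [Exp.eval, Store.setArr_var, Store.setVar_var, hσ₃, hσ₂, hσ₁]
    simp only [Nat.reduceEqDiff, if_true, if_false, h7, hτ, hlay, hlt,
      apply_ite (Fin.val (n := n))]
  rw [hrun]
  refine ⟨hG.congr fun a ha => ?_, fun l hl => ?_, by simp [searchStep], ?_⟩
  · funext j
    simp [Store.setArr_arr, hσ₃, hσ₂, hσ₁, show a ≠ 3 by omega, show a ≠ 4 by omega]
  · simp only [searchStep, List.length_append, List.length_singleton] at hl
    simp only [Store.setVar_arr, Store.setArr_arr, hσ₃, hσ₂, hσ₁, searchStep]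
    rcases Nat.lt_succ_iff_lt_or_eq.1 hl with h | rfl
    · simpa [List.getElem_append_left h, h.ne] using hcs l h
    · simp [nextCop, ← he, ← hd]
  · simp [hσ₃, hσ₂, hσ₁]

/-- Try all codes; the answer is in variable `15`. -/
def searchCmd : Cmd :=
  .seq (.assign 15 (.const 0)) <|
  .loop 9 3 <|
  .seq (.assign 10 (.var 9)) <|
  .seq (.loop 7 2 stepCmd) <|
  .seq (.assign 7 (.prm 2)) <|
  .assign 15 (.ite (.sum 3 0 (.sum 4 0 badExp)) (.var 15) (.const 1))

/-- Codes only shrink, so they stay below `ρ 3`, as the division requires. -/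
theorem searchStep_iterate_snd_le {V : Type*} {hτ : 0 < τ}
    {pick : List (Fin τ × V) → V × V} (m : ℕ) (x : List (Fin τ × V) × ℕ) :
    ((searchStep hτ pick)^[m] x).2 ≤ x.2 := by
  induction m with
  | zero => exact le_rfl
  | succ m ih =>
    rw [Function.iterate_succ_apply']
    exact (Nat.div_le_self _ _).trans ih

theorem run_trial (hn : ρ 0 = n) (hpos : 0 < n) (hτ : ρ 1 = τ) (hτ0 : 0 < τ) {σ : Store}
    {code : ℕ} (hG : Prepared G σ) (h10 : σ.var 10 = code) (hcode : code < ρ 3) :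
    Prepared G ((Cmd.loop 7 2 stepCmd).run ρ σ) ∧
      Holds ((searchStep hτ0 (pick hpos G))^[ρ 2] ([], code)).1
        ((Cmd.loop 7 2 stepCmd).run ρ σ) ∧
      ((Cmd.loop 7 2 stepCmd).run ρ σ).var 15 = σ.var 15 := by
  obtain ⟨h1, h2, -, h4⟩ := Cmd.run_loop_of_inv (ρ := ρ) (x := 7) (p := 2) (c := stepCmd)
    (I := fun j σ' => Prepared G σ' ∧
      Holds ((searchStep hτ0 (pick hpos G))^[j] ([], code)).1 σ' ∧
      σ'.var 10 = ((searchStep hτ0 (pick hpos G))^[j] ([], code)).2 ∧ σ'.var 15 = σ.var 15)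
    (σ := σ) ⟨hG, fun l h => absurd h (Nat.not_lt_zero _), h10, rfl⟩
    (by
      rintro j hj σ' ⟨h1, h2, h3, h4⟩
      have hlen := length_searchStep_iterate hτ0 (pick hpos G) j ([], code)
      have hle := searchStep_iterate_snd_le (hτ := hτ0) (pick := pick hpos G) j ([], code)
      simp only [List.length_nil, zero_add] at hlen
      dsimp only at hle
      obtain ⟨g1, g2, g3, g4⟩ := run_stepCmd hn hpos hτ hτ0 (σ := σ'.setVar 7 j)
        (x := (searchStep hτ0 (pick hpos G))^[j] ([], code)) (h1.congr fun _ _ => rfl)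
        (h2.congr rfl rfl) (by omega) (by simp [hlen]) (by simpa using h3) (by omega)
      rw [Function.iterate_succ_apply']
      exact ⟨g1, g2, g3, g4.trans (by simpa using h4)⟩)
  exact ⟨h1, h2, h4⟩

theorem run_searchCmd (hn : ρ 0 = n) (hpos : 0 < n) (hτ : ρ 1 = τ) (hτ0 : 0 < τ) {σ : Store}
    (hG : Prepared G σ) :
    (searchCmd.run ρ σ).var 15 ≤ 1 ∧ ((searchCmd.run ρ σ).var 15 = 1 ↔
      ∃ code < ρ 3, G.Solves ((searchStep hτ0 (pick hpos G))^[ρ 2] ([], code)).1) := by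
  refine (Cmd.run_loop_of_inv (ρ := ρ) (x := 9) (p := 3) (I := fun m σ' => Prepared G σ' ∧
    σ'.var 15 ≤ 1 ∧ (σ'.var 15 = 1 ↔ ∃ code < m,
      G.Solves ((searchStep hτ0 (pick hpos G))^[ρ 2] ([], code)).1))
    (σ := σ.setVar 15 0) ⟨hG.congr fun _ _ => rfl, by simp, by simp⟩ ?_).2
  rintro j hj σ' ⟨h1, h2, h3⟩
  obtain ⟨g1, g2, g3⟩ := run_trial hn hpos hτ hτ0
    (σ := (σ'.setVar 9 j).setVar 10 ((σ'.setVar 9 j).var 9)) (code := j)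
    (h1.congr fun _ _ => rfl) (by simp) hj
  have hlen := length_searchStep_iterate hτ0 (pick hpos G) (ρ 2) ([], j)
  simp only [List.length_nil, zero_add] at hlen
  set T := (Cmd.loop 7 2 stepCmd).run ρ ((σ'.setVar 9 j).setVar 10 ((σ'.setVar 9 j).var 9))
  -- The last pass leaves variable `7` one below the number of cops; resetting it to `ρ 2` makes the
  -- final test count all of them.
  have hsol := sum_sum_badExp_iff (σ := T.setVar 7 (ρ 2)) hn (g1.congr fun _ _ => rfl)
    (g2.congr rfl rfl) hlen.le (by simp [hlen])
  have g3' : T.var 15 = σ'.var 15 := by simpa using g3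
  have hrun : Cmd.run ρ (.seq (.assign 10 (.var 9)) <| .seq (.loop 7 2 stepCmd) <|
      .seq (.assign 7 (.prm 2)) <|
      .assign 15 (.ite (.sum 3 0 (.sum 4 0 badExp)) (.var 15) (.const 1))) (σ'.setVar 9 j) =
      (T.setVar 7 (ρ 2)).setVar 15
        (if (Exp.sum 3 0 (.sum 4 0 badExp)).eval ρ (T.setVar 7 (ρ 2)) ≠ 0
          then (T.setVar 7 (ρ 2)).var 15 else 1) := rfl
  rw [hrun]
  refine ⟨g1.congr fun _ _ => rfl, ?_⟩
  rw [show (T.setVar 7 (ρ 2)).var 15 = σ'.var 15 by simp [g3'], Store.setVar_var, if_pos rfl]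
  simp only [Nat.lt_succ_iff_lt_or_eq, or_and_right, exists_or, exists_eq_left, ← h3]
  split_ifs with h
  · exact ⟨h2, by simp [hsol.1 h]⟩
  · exact ⟨le_rfl, by simp [not_not.1 (hsol.not.1 h)]⟩

end RAM

/-! ## The decision procedure -/

namespace RAM

open MultiLayerGraph

/-- Compute the number `(2 * τ) ^ k` of codes in variable `0`. -/
def sizeCmd : Cmd :=
  .seq (.assign 0 (.const 1)) (.loop 1 2 (.assign 0 (.sum 2 1 (.add (.var 0) (.var 0)))))

theorem run_sizeCmd (ρ : ℕ → ℕ) (σ : Store) :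
    (sizeCmd.run ρ σ).var 0 = (2 * ρ 1) ^ ρ 2 ∧ (sizeCmd.run ρ σ).arr = σ.arr := by
  refine Cmd.run_loop_of_inv (ρ := ρ) (x := 1) (p := 2)
    (I := fun j σ' => σ'.var 0 = (2 * ρ 1) ^ j ∧ σ'.arr = σ.arr) (σ := σ.setVar 0 1)
    ⟨by simp, rfl⟩ ?_
  rintro j - σ' ⟨h1, h2⟩
  refine ⟨?_, h2⟩
  simp only [Cmd.run, Exp.eval, Store.setVar_var, Finset.sum_const, Finset.card_range,
    smul_eq_mul, if_true, if_false, OfNat.zero_ne_ofNat, zero_ne_one, h1]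
  rw [pow_succ]
  ring

/-- The parameters of the two stages of the decision procedure. -/
def params (n τ k M p : ℕ) : ℕ :=
  if p = 0 then n else if p = 1 then τ else if p = 2 then k else if p = 3 then M else 0

/-- The program that decides `Multi-layer cops and robber` when the robber layer is a tree. -/
def decideProg : Prog :=
  .seq (.const 5 0) <| .seq (.add 3 1 5) <| .seq (.add 6 2 5) <|
  .seq (sizeCmd.compile 0) <|
  .seq (.const (tmpReg 0) 0) <| .seq (.add (prmReg 3) (varReg 0) (tmpReg 0)) <|
  .seq ((Cmd.seq reachCmd searchCmd).compile 0) <|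
  .seq (.const (tmpReg 0) 0) (.add 0 (varReg 15) (tmpReg 0))

theorem copLayers_inputState {n τ : ℕ} (G : MultiLayerGraph (Fin n) τ) (k : ℕ) :
    CopLayers G ((inputState G k).arr 0) := by
  classical
  intro i u v
  have hc : ∀ i u v : ℕ, (i * n + u) * n + v = cellIndex n i u v := fun i u v => by
    rw [cellIndex, mul_comm i n, mul_comm _ n]
  simp only [inputState, if_true]
  rw [ite_ne_right_iff]
  constructor
  · rintro ⟨⟨i', u', v', h, hadj⟩, -⟩
    obtain ⟨h1, h2, h3⟩ := cellIndex_inj u.2 v.2 u'.2 v'.2 (h.trans (hc _ _ _))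
    obtain rfl := Fin.ext h1
    obtain rfl := Fin.ext h2
    obtain rfl := Fin.ext h3
    exact hadj
  · exact fun h => ⟨⟨i, u, v, (hc _ _ _).symm, h⟩, one_ne_zero⟩

theorem robberLayer_inputState {n τ : ℕ} (G : MultiLayerGraph (Fin n) τ) (k : ℕ) (u v : Fin n) :
    (inputState G k).arr 1 (n * u + v) ≠ 0 ↔ G.robberLayer.Adj u v := by
  classical
  simp only [inputState, if_true, if_false, one_ne_zero]
  rw [ite_ne_right_iff]
  constructor
  · rintro ⟨⟨u', v', h, hadj⟩, -⟩
    obtain ⟨h1, h2⟩ := mul_add_inj v.2 v'.2 (h.trans (by rw [mul_comm _ n]))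
    obtain rfl := Fin.ext h1
    obtain rfl := Fin.ext h2
    exact hadj
  · exact fun h => ⟨⟨u, v, by rw [mul_comm], h⟩, one_ne_zero⟩

theorem run_decideProg {n τ k : ℕ} (G : MultiLayerGraph (Fin n) τ) (hτ : 0 < τ) (hk : 1 ≤ k)
    (hR : G.robberLayer.IsTree) :
    Run decideProg (inputState G k)
      (sizeCmd.cost (params n τ k ((2 * τ) ^ k)) +
        (Cmd.seq reachCmd searchCmd).cost (params n τ k ((2 * τ) ^ k)) + 7)
      fun s => s.reg 0 ≤ 1 ∧ (s.reg 0 = 1 ↔ G.MultiLayerCopsAndRobber k) := by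
  have hpos : 0 < n := hR.1.nonempty.elim fun x => x.pos
  -- The first stage runs before parameter `3` is known, and its cost does not depend on it.
  have hcost : sizeCmd.cost (params n τ k ((2 * τ) ^ k)) = sizeCmd.cost (params n τ k 0) := rfl
  rw [hcost]
  refine Run.mono (C := 1 + (1 + (1 + (sizeCmd.cost (params n τ k 0) + (1 + (1 +
    ((Cmd.seq reachCmd searchCmd).cost (params n τ k ((2 * τ) ^ k)) + (1 + 1)))))))) ?_
    (by omega) (fun _ h => h)
  refine Run.const_seq (Run.add_seq (Run.add_seq ?_))
  generalize hs : ((inputState G k).setReg 5 0).setReg 3 _ = s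
  generalize hs' : s.setReg 6 _ = s₁
  have hreg : ∀ x, s₁.reg x = if x = 6 then k else if x = 3 then τ else if x = 5 then 0 else
      if x = 0 then n else if x = 1 then τ else if x = 2 then k else 0 := fun x => by
    simp [← hs', ← hs, inputState]
  have harr : s₁.arr = (inputState G k).arr := by rw [← hs', ← hs]; rfl
  -- The input registers 1 and 2 are also `varReg 0` and `tmpReg 0`. Their contents were copied to
  -- `prmReg 1` and `prmReg 2`, and the leftovers are harmless: the store simply starts with what
  -- the registers hold.
  have hsim : Sim (params n τ k 0) ⟨fun x => s₁.reg (varReg x), s₁.arr⟩ s₁ := by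
    refine ⟨fun p => ?_, fun _ => rfl, rfl⟩
    rw [hreg, prmReg, params]
    split_ifs <;> first | rfl | omega
  refine Run.seq (Cmd.run_compile _ sizeCmd 0 _ s₁ hsim) fun s₂ ⟨hsim₂, _⟩ => ?_
  obtain ⟨hM, harr₂⟩ := run_sizeCmd (params n τ k 0) ⟨fun x => s₁.reg (varReg x), s₁.arr⟩
  generalize sizeCmd.run (params n τ k 0) _ = σ at hsim₂ hM harr₂
  replace hM : σ.var 0 = (2 * τ) ^ k := hM
  replace harr₂ : σ.arr = (inputState G k).arr := harr₂.trans harr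
  refine Run.const_seq (Run.add_seq ?_)
  have hval : (s₂.setReg (tmpReg 0) 0).reg (varReg 0) + (s₂.setReg (tmpReg 0) 0).reg (tmpReg 0) =
      (2 * τ) ^ k := by simp [hsim₂.var, hM]
  rw [hval]
  have hsim₃ : Sim (params n τ k ((2 * τ) ^ k)) σ
      ((s₂.setReg (tmpReg 0) 0).setReg (prmReg 3) ((2 * τ) ^ k)) := by
    refine ⟨fun p => ?_, fun x => ?_, hsim₂.arr⟩
    · have h := hsim₂.prm p
      by_cases hp : p = 3
      · subst hp; simp [params]
      · have : prmReg p ≠ prmReg 3 := by simp only [prmReg]; omega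
        simp [this, h, params, hp]
    · simp [(prmReg_ne_varReg 3 x).symm, hsim₂.var]
  refine Run.seq (Cmd.run_compile _ _ 0 _ _ hsim₃) fun s₃ ⟨hsim₄, _⟩ => ?_
  refine Run.const_seq (Run.add ?_)
  obtain ⟨ha, hreach⟩ := run_reachCmd (G := G) (ρ := params n τ k ((2 * τ) ^ k)) (σ := σ) rfl rfl
    (harr₂ ▸ copLayers_inputState G k) (by rw [harr₂]; funext j; simp [inputState])
  have hprep : Prepared G (reachCmd.run (params n τ k ((2 * τ) ^ k)) σ) := by
    refine ⟨?_, ?_, hreach⟩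
    · rw [ha 0 (by omega), harr₂]; exact copLayers_inputState G k
    · rw [ha 1 (by omega), harr₂]; exact robberLayer_inputState G k
  obtain ⟨h1, h2⟩ := run_searchCmd (ρ := params n τ k ((2 * τ) ^ k)) rfl hpos rfl hτ hprep
  have hout := hsim₄.var 15
  simp only [Cmd.run] at hout
  have hfin : ((s₃.setReg (tmpReg 0) 0).setReg 0
      ((s₃.setReg (tmpReg 0) 0).reg (varReg 15) + (s₃.setReg (tmpReg 0) 0).reg (tmpReg 0))).reg 0 =
      (searchCmd.run (params n τ k ((2 * τ) ^ k))
        (reachCmd.run (params n τ k ((2 * τ) ^ k)) σ)).var 15 := by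
    simp [hout]
  rw [hfin, multiLayerCopsAndRobber_iff_code hR hk (hτ := hτ) (pick_spec hpos G)]
  exact ⟨h1, h2⟩

/-! ### Computability and shape of the time bound -/

theorem primrec₂_pow : Primrec₂ fun a b : ℕ => a ^ b := by
  have h : Primrec₂ fun (a : ℕ) (b : ℕ) => (Nat.rec 1 (fun _ x => x * a) b : ℕ) :=
    Primrec.nat_rec (f := fun _ : ℕ => 1) (g := fun a p => p.2 * a) (.const 1)
      (Primrec.nat_mul.comp (Primrec.snd.comp Primrec.snd) Primrec.fst).to₂
  refine h.of_eq fun a b => ?_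
  induction b with
  | zero => rfl
  | succ b ih => rw [pow_succ, ← ih]

theorem primrec₂_timeBound (N : ℕ) :
    Primrec₂ fun k τ : ℕ => ((τ + 2) * ((k + 2) * ((2 * τ) ^ k + 2))) ^ N := by
  have hadd : ∀ {f : ℕ × ℕ → ℕ}, Primrec f → Primrec fun x => f x + 2 := fun hf =>
    Primrec.nat_add.comp hf (.const 2)
  have hpow : Primrec fun x : ℕ × ℕ => (2 * x.2) ^ x.1 :=
    primrec₂_pow.comp (Primrec.nat_mul.comp (.const 2) .snd) .fst
  have h : Primrec fun x : ℕ × ℕ => ((x.2 + 2) * ((x.1 + 2) * ((2 * x.2) ^ x.1 + 2))) ^ N :=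
    primrec₂_pow.comp (Primrec.nat_mul.comp (hadd .snd)
      (Primrec.nat_mul.comp (hadd .fst) (hadd hpow))) (.const N)
  exact h

theorem exists_fpt_algorithm : ∃ (prog : Prog) (f : ℕ → ℕ → ℕ) (poly : Polynomial ℕ),
    Computable₂ f ∧ ∀ (n τ k : ℕ) (G : MultiLayerGraph (Fin n) τ), 1 ≤ τ → 1 ≤ k →
      G.robberLayer.IsTree → ∃ (t : ℕ) (s : State), Exec prog (inputState G k) t s ∧
        t ≤ f k τ * poly.eval n ∧
        s.reg 0 ≤ 1 ∧ (s.reg 0 = 1 ↔ G.MultiLayerCopsAndRobber k) := by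
  obtain ⟨N, hN⟩ := (sizeCmd.powBounded_cost.add
    (Cmd.seq reachCmd searchCmd).powBounded_cost).add (.const 7)
  refine ⟨decideProg, _, (Polynomial.X + 2) ^ N, (primrec₂_timeBound N).to_comp, ?_⟩
  intro n τ k G hτ hk hR
  obtain ⟨t, s, hexec, ht, hs⟩ := run_decideProg G hτ hk hR
  refine ⟨t, s, hexec, ht.trans ?_, hs⟩
  set M := (2 * τ) ^ k
  have h1 : 1 ≤ (τ + 2) * ((k + 2) * (M + 2)) := Nat.pos_of_ne_zero (by positivity)
  -- A product rather than a maximum serves as the common bound, because its `N`-th power separates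
  -- `n` from `k` and `τ`.
  have hB : ∀ p, params n τ k M p ≤ (τ + 2) * ((k + 2) * (M + 2)) * (n + 2) := by
    have e1 : n ≤ (τ + 2) * ((k + 2) * (M + 2)) * (n + 2) :=
      le_trans (by omega) (Nat.le_mul_of_pos_left (n + 2) h1)
    have e2 : (τ + 2) * ((k + 2) * (M + 2)) ≤ (τ + 2) * ((k + 2) * (M + 2)) * (n + 2) :=
      Nat.le_mul_of_pos_right _ (by omega)
    have e3 : (k + 2) * (M + 2) ≤ (τ + 2) * ((k + 2) * (M + 2)) :=
      Nat.le_mul_of_pos_left _ (by omega)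
    have e4 : τ + 2 ≤ (τ + 2) * ((k + 2) * (M + 2)) :=
      Nat.le_mul_of_pos_right _ (by positivity)
    have e5 : k + 2 ≤ (k + 2) * (M + 2) := Nat.le_mul_of_pos_right _ (by omega)
    have e6 : M + 2 ≤ (k + 2) * (M + 2) := Nat.le_mul_of_pos_left _ (by omega)
    intro p
    unfold params
    split_ifs <;> omega
  have h2 : 2 ≤ (τ + 2) * ((k + 2) * (M + 2)) * (n + 2) :=
    le_trans (by omega) (Nat.le_mul_of_pos_left (n + 2) h1)
  refine (hN _ _ h2 hB).trans_eq ?_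
  rw [mul_pow]
  simp

end RAM

theorem mainTheorem6 :
    -- one program decides the problem in time `f(k, τ) * poly(n)` when the robber layer is a tree
    (∃ (prog : RAM.Prog) (f : ℕ → ℕ → ℕ) (poly : Polynomial ℕ), Computable₂ f ∧
      ∀ (n τ k : ℕ) (G : MultiLayerGraph (Fin n) τ), 1 ≤ τ → 1 ≤ k → G.robberLayer.IsTree →
        ∃ (t : ℕ) (s : RAM.State), RAM.Exec prog (RAM.inputState G k) t s ∧
          t ≤ f k τ * poly.eval n ∧
          s.reg 0 ≤ 1 ∧ (s.reg 0 = 1 ↔ G.MultiLayerCopsAndRobber k)) ∧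
    -- the cops win exactly when there is no robber's edge
    (∀ (V : Type*) [Finite V] (τ : ℕ) (G : MultiLayerGraph V τ) (κ : Fin τ → ℕ),
      1 ≤ τ → 1 ≤ ∑ i, κ i → G.robberLayer.IsTree →
        (∀ p : MultiLayerGraph.Cop κ → V,
          G.CopsWinFrom κ p ↔ ¬ ∃ u v : V, G.IsRobbersEdge p u v) ∧
        (G.AllocatedMultiLayerCopsAndRobber κ ↔
          ∃ p : MultiLayerGraph.Cop κ → V, ¬ ∃ u v : V, G.IsRobbersEdge p u v)) := by
  refine ⟨RAM.exists_fpt_algorithm, fun V _ τ G κ _ hκ hR => ?_⟩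
  have h := fun p => MultiLayerGraph.copsWinFrom_iff_no_robbersEdge (G := G) hκ hR p
  exact ⟨h, exists_congr h⟩
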